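/- **Setting.** Let $n\in\mathbb N$, $a\in\mathbb R$, $1<\beta<\alpha\le 2$, and for $1\le j\le n$ let $\mu_j>0$, $0<\gamma_j\le 2$, $|\theta_j|\le\min(\gamma_j,2-\gamma_j)$. Write $f^*(k)=\int_{\mathbb R}e^{ikx}f(x)\,dx$ (for functions of $(x,t)$, in the variable $x$), $$\psi_\gamma^\theta(k)=|k|^\gamma e^{i\,\mathrm{sign}(k)\theta\pi/2},\qquad b=b(k)=\sum_{j=1}^n\mu_j\psi_{\gamma_j}^{\theta_j}(k),\qquad E^{c}_{\alpha,\kappa}(z)=\sum_{m\ge0}\frac{(c)_m z^m}{\Gamma(\alpha m+\kappa)\,m!}.$$ For $\nu>-1$ let ${}_0D_t^\nu u(t)=\frac1{\Gamma(m-\nu)}\frac{d^m}{dt^m}\int_0^t(t-\tau)^{m-\nu-1}u(\tau)\,d\tau$ with $m=[\nu]+1$ (Riemann–Liouville; for $\nu<0$ a fractional integral). For integrable $f$, ${}_xD_\theta^\gamma f$ is the integrable function with Fourier transform $-\psi_\gamma^\theta(k)f^*(k)$. Let $$S_\kappa(b,t)=\sum_{r=0}^\infty(-a)^r t^{(\alpha-\beta)r}E^{r+1}_{\alpha,\kappa+(\alpha-\beta)r}(-bt^\alpha).$$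 **Problem.** Let $f_1,f_2,g_1,g_2\in L^1(\mathbb R)$ and consider, for $x\in\mathbb R$, $t>0$, $${}_0D_t^\alpha N+a\,{}_0D_t^\beta N=\sum_{j=1}^n\mu_j\,{}_xD_{\theta_j}^{\gamma_j}N+\phi,\qquad \lim_{x\to\pm\infty}N(x,t)=0,$$ with the initial conditions, as $t\to0+$ and for every $x$, $${}_0D_t^{\alpha-1}N+a\,{}_0D_t^{\beta-1}N\to f_1+af_2,\qquad {}_0D_t^{\alpha-2}N+a\,{}_0D_t^{\beta-2}N\to g_1+ag_2$$ (in particular this holds if ${}_0D_t^{\alpha-1}N\to f_1$, ${}_0D_t^{\beta-1}N\to f_2$, ${}_0D_t^{\alpha-2}N\to g_1$, ${}_0D_t^{\beta-2}N\to g_2$ separately). A solution is a function $N:\mathbb R\times(0,\infty)\to\mathbb C$ satisfying these relations pointwise, whose fractional derivatives in the equation exist, such that $N(\cdot,t)$ is continuous and integrable for each $t>0$, $t\mapsto N^*(k,t)$ is continuous on $(0,\infty)$ for each $k$, and the joint Laplace–Fourier transforms of $N$ and of the ${}_xD_{\theta_j}^{\gamma_j}N$ converge absolutely for some Laplace variable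 $s$; the same absolute convergence is assumed of $\phi$. **Theorem.** 1. For $\kappa\in\{\alpha,\alpha-1\}$, $b\in\mathbb C$, $t>0$, the series defining $S_\kappa(b,t)$ and the Prabhakar functions in it converge absolutely. 2. For $\kappa\in\{\alpha,\alpha-1\}$ and $b\in\mathbb C$ there is $\sigma\ge0$ such that for $\Re s>\sigma$ the denominator below is non-zero, the integral converges absolutely, and $$\int_0^\infty e^{-st}\,t^{\kappa-1}S_\kappa(b,t)\,dt=\frac{s^{\alpha-\kappa}}{s^\alpha+as^\beta+b}.$$ 3. For every solution $N$ and all $t>0$, $k\in\mathbb R$, with a convergent series over $r$, $$N^*(k,t)=t^{\alpha-1}(f_1^*+af_2^*)(k)S_\alpha(b,t)+t^{\alpha-2}(g_1^*+ag_2^*)(k)S_{\alpha-1}(b,t)+\sum_{r=0}^\infty(-a)^r\int_0^t\phi^*(k,t-\xi)\,\xi^{\alpha+(\alpha-\beta)r-1}E^{r+1}_{\alpha,\alpha+(\alpha-\beta)r}(-b\xi^\alpha)\,d\xi .$$ 4. For every solution $N$, every $t>0$ and all $x\in\mathbb R$, $$\begin{aligned}N(x,t)&=\frac{t^{\alpha-1}}{2\pi}\int_{\mathbb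 R}(f_1^*+af_2^*)(k)\,S_\alpha(b,t)e^{-ikx}dk+\frac{t^{\alpha-2}}{2\pi}\int_{\mathbb R}(g_1^*+ag_2^*)(k)\,S_{\alpha-1}(b,t)e^{-ikx}dk\\&\quad+\frac1{2\pi}\int_0^t\xi^{\alpha-1}\int_{\mathbb R}\phi^*(k,t-\xi)\,S_\alpha(b,\xi)e^{-ikx}\,dk\,d\xi,\end{aligned}$$ provided the integrals on the right converge absolutely (the first two in $k$, the third in $(\xi,k)$). 5. In 4, the last term equals $$\sum_{r=0}^\infty\frac{(-a)^r}{2\pi}\int_0^t\xi^{\alpha+(\alpha-\beta)r-1}\int_{\mathbb R}\phi^*(k,t-\xi)E^{r+1}_{\alpha,\alpha+(\alpha-\beta)r}(-b\xi^\alpha)e^{-ikx}\,dk\,d\xi ,$$ and the series converges, if the first two integrals converge absolutely and this iterated sum of integrals over $r$ and $(\xi,k)$ converges absolutely. -/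

import Mathlib

open MeasureTheory Set Filter Topology

noncomputable section

/-- Fourier transform in the space variable, `f^*(k) = ∫ exp(i k x) f(x) dx`. -/
def fourierT (f : ℝ → ℂ) (k : ℝ) : ℂ :=
  ∫ x : ℝ, Complex.exp (Complex.I * k * x) * f x

/-- The symbol `ψ_γ^θ(k) = |k|^γ exp(i sign(k) θ π / 2)`. -/
def fellerSymbol (γ θ k : ℝ) : ℂ :=
  ((|k| ^ γ : ℝ) : ℂ) * Complex.exp (Complex.I * (Real.sign k * (θ * Real.pi / 2) : ℝ))

/-- `h` is the Riesz-Feller derivative of order `γ` and skewness `θ` of `f`: both functions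
are integrable and `h^*(k) = -ψ_γ^θ(k) f^*(k)` for all `k`. -/
def IsRieszFellerDeriv (γ θ : ℝ) (f h : ℝ → ℂ) : Prop :=
  Integrable f ∧ Integrable h ∧
    ∀ k : ℝ, fourierT h k = -(fellerSymbol γ θ k) * fourierT f k

/-- Riemann-Liouville fractional integral of order `δ > 0`. -/
def rlIntegral (δ : ℝ) (u : ℝ → ℂ) (t : ℝ) : ℂ :=
  ((1 / Real.Gamma δ : ℝ) : ℂ) * ∫ τ in (0 : ℝ)..t, (((t - τ) ^ (δ - 1) : ℝ) : ℂ) * u τ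

/-- The integer `[ν] + 1` (for `ν ≥ -1`). -/
def rlOrder (ν : ℝ) : ℕ := (⌊ν⌋ + 1).toNat

/-- Riemann-Liouville fractional derivative of order `ν`,
`1 / Γ(n - ν) * d^n/dt^n ∫_0^t (t - τ)^(n - ν - 1) u(τ) dτ` with `n = [ν] + 1`.
For `-1 < ν < 0` this is the fractional integral of order `-ν`. -/
def rlDeriv (ν : ℝ) (u : ℝ → ℂ) (t : ℝ) : ℂ :=
  iteratedDeriv (rlOrder ν) (rlIntegral ((rlOrder ν : ℝ) - ν) u) t

/-- The Riemann-Liouville derivative of order `ν` of `u` exists at every `t > 0`: the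
integral in its definition converges and can be differentiated `[ν] + 1` times. -/
def RLDifferentiable (ν : ℝ) (u : ℝ → ℂ) : Prop :=
  (∀ t : ℝ, 0 < t → IntervalIntegrable
      (fun τ : ℝ => (((t - τ) ^ ((rlOrder ν : ℝ) - ν - 1) : ℝ) : ℂ) * u τ) volume 0 t) ∧
  ∀ m : ℕ, m < rlOrder ν → ∀ t : ℝ, 0 < t →
    DifferentiableAt ℝ (iteratedDeriv m (rlIntegral ((rlOrder ν : ℝ) - ν) u)) t

/-- The joint Laplace-Fourier transform of `u(x,t)`, `t > 0`, converges absolutely for some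
(hence for every larger) Laplace variable. -/
def JointlyTransformable (u : ℝ → ℝ → ℂ) : Prop :=
  ∃ σ : ℝ, Integrable (fun p : ℝ × ℝ => ((Real.exp (-σ * p.2) : ℝ) : ℂ) * u p.1 p.2)
    ((volume : Measure ℝ).prod (volume.restrict (Ioi (0 : ℝ))))

/-- The initial conditions at the point `x` for `u = N(x,·)`. For the equation
`D^α u + a D^β u = …` only the combinations `D^(α-1) u + a D^(β-1) u` and
`D^(α-2) u + a D^(β-2) u` have to converge as `t → 0+`; see `HasInitialData.of_separate` for
the case in which all four limits exist. -/
def HasInitialData (α β a : ℝ) (u : ℝ → ℂ) (f₁ f₂ g₁ g₂ : ℂ) : Prop :=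
  Tendsto (fun t => rlDeriv (α - 1) u t + (a : ℂ) * rlDeriv (β - 1) u t) (𝓝[>] 0)
    (𝓝 (f₁ + a * f₂)) ∧
  Tendsto (fun t => rlDeriv (α - 2) u t + (a : ℂ) * rlDeriv (β - 2) u t) (𝓝[>] 0)
    (𝓝 (g₁ + a * g₂))

/-- The four separate initial conditions imply the combined ones. -/
theorem HasInitialData.of_separate (α β a : ℝ) (u : ℝ → ℂ) (f₁ f₂ g₁ g₂ : ℂ)
    (hf₁ : Tendsto (rlDeriv (α - 1) u) (𝓝[>] 0) (𝓝 f₁))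
    (hg₁ : Tendsto (rlDeriv (α - 2) u) (𝓝[>] 0) (𝓝 g₁))
    (hf₂ : Tendsto (rlDeriv (β - 1) u) (𝓝[>] 0) (𝓝 f₂))
    (hg₂ : Tendsto (rlDeriv (β - 2) u) (𝓝[>] 0) (𝓝 g₂)) :
    HasInitialData α β a u f₁ f₂ g₁ g₂ :=
  ⟨hf₁.add (hf₂.const_mul _), hg₁.add (hg₂.const_mul _)⟩

/-- `N` is a solution of
`D_t^α N + a D_t^β N = ∑ j, μ j * D_{θ j}^{γ j} N + φ` on `x ∈ ℝ`, `t > 0`, with initial data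
`f₁, f₂, g₁, g₂`, for which the joint Laplace-Fourier transform can be applied to the equation.
Here `h j` is the Riesz-Feller derivative of order `γ j` and skewness `θ j` of `N`. -/
structure IsSolutionWith {n : ℕ} (α β a : ℝ) (μ γ θ : Fin n → ℝ) (φ : ℝ → ℝ → ℂ)
    (f₁ f₂ g₁ g₂ : ℝ → ℂ) (N : ℝ → ℝ → ℂ) (h : Fin n → ℝ → ℝ → ℂ) : Prop where
  rl_alpha : ∀ x : ℝ, RLDifferentiable α (N x)
  rl_beta : ∀ x : ℝ, RLDifferentiable β (N x)
  riesz_feller : ∀ j : Fin n, ∀ t : ℝ, 0 < t →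
    IsRieszFellerDeriv (γ j) (θ j) (fun x => N x t) (fun x => h j x t)
  equation : ∀ x t : ℝ, 0 < t →
    rlDeriv α (N x) t + (a : ℂ) * rlDeriv β (N x) t = ∑ j, (μ j : ℂ) * h j x t + φ x t
  initial : ∀ x : ℝ, HasInitialData α β a (N x) (f₁ x) (f₂ x) (g₁ x) (g₂ x)
  vanishing : ∀ t : ℝ, 0 < t → Tendsto (fun x => N x t) (cocompact ℝ) (𝓝 0)
  continuous_space : ∀ t : ℝ, 0 < t → Continuous (fun x => N x t)
  integrable_space : ∀ t : ℝ, 0 < t → Integrable (fun x => N x t)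
  continuous_time : ∀ k : ℝ, ContinuousOn (fun t => fourierT (fun x => N x t) k) (Ioi 0)
  transformable : JointlyTransformable N
  transformable_deriv : ∀ j : Fin n, JointlyTransformable (h j)

/-- `N` is a solution of the initial value problem. -/
def IsSolution {n : ℕ} (α β a : ℝ) (μ γ θ : Fin n → ℝ) (φ : ℝ → ℝ → ℂ)
    (f₁ f₂ g₁ g₂ : ℝ → ℂ) (N : ℝ → ℝ → ℂ) : Prop :=
  ∃ h : Fin n → ℝ → ℝ → ℂ, IsSolutionWith α β a μ γ θ φ f₁ f₂ g₁ g₂ N h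

/-- The `m`-th term of the Prabhakar function `E^c_{α,κ}(z)`. -/
def prabhakarTerm (c α κ : ℝ) (z : ℂ) (m : ℕ) : ℂ :=
  (((ascPochhammer ℝ m).eval c / (Real.Gamma (α * m + κ) * (m.factorial : ℝ)) : ℝ) : ℂ) * z ^ m

/-- The three-parameter (Prabhakar) Mittag-Leffler function
`E^c_{α,κ}(z) = ∑ m, (c)_m z^m / (Γ(α m + κ) m!)`. -/
def prabhakar (c α κ : ℝ) (z : ℂ) : ℂ := ∑' m : ℕ, prabhakarTerm c α κ z m

/-- The term `(-a)^r t^((α-β) r) E^{r+1}_{α,κ+(α-β)r}(-b t^α)`. -/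
def mlTerm (α β a κ : ℝ) (b : ℂ) (t : ℝ) (r : ℕ) : ℂ :=
  ((-a : ℝ) : ℂ) ^ r * ((t ^ ((α - β) * r) : ℝ) : ℂ) *
    prabhakar (r + 1) α (κ + (α - β) * r) (-b * ((t ^ α : ℝ) : ℂ))

/-- The series `∑ r, (-a)^r t^((α-β) r) E^{r+1}_{α,κ+(α-β)r}(-b t^α)`. -/
def mlSeries (α β a κ : ℝ) (b : ℂ) (t : ℝ) : ℂ := ∑' r : ℕ, mlTerm α β a κ b t r

/-- `b(k) = ∑ j, μ j * ψ_{γ j}^{θ j}(k)`. -/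
def totalSymbol {n : ℕ} (μ γ θ : Fin n → ℝ) (k : ℝ) : ℂ :=
  ∑ j, (μ j : ℂ) * fellerSymbol (γ j) (θ j) k

end

/-! Expanding the Prabhakar functions turns `t^(κ-1) S_κ(b,t)` into a double series of powers of
`t`. Its coefficients are the binomials of the expansion of `1/(1-x-y)` divided by Gamma values, and
these are cancelled by the Laplace transform of a power. With `x = -a s^(β-α)` and `y = -b s^(-α)`,
which are small for large `Re s`, the transform sums to `s^(α-κ) / (s^α + a s^β + b)`. Convergence
for every fixed `t` comes from `Γ(x) ≥ R^x exp(-2R) / 2` with `R` free, which bounds the series by a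
convergent one of the same binomial shape.

For a solution, the combinations `D^(α-2) N + a D^(β-2) N` and `D^(α-1) N + a D^(β-1) N` are
successive antiderivatives of the right-hand side, and their limits at `0+` are the initial data.
Two integrations under the Laplace transform therefore give an algebraic equation for almost every
`x` (`laplaceT_equation`). A Fourier transform in `x`, exchanged with the Laplace integral by
Fubini, gives `(s^α + a s^β + b(k))` times the joint transform of `N`
(`IsSolutionWith.exists_laplaceT_fourierT`).

The proposed formula for `N^*(k,·)` has the same Laplace transform, so the two agree almost
everywhere by injectivity, and then everywhere because both are continuous on `t > 0`
(`IsSolutionWith.fourierT_eq`). The absolute convergence assumed in parts 4 and 5 makes `N^*(·,t)`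
integrable, so Fourier inversion holds at every `x` by continuity of `N(·,t)`. -/

noncomputable section

/-! ### Laplace transform: linearity and convolution. -/

/-- The Laplace transform `∫_0^∞ exp(-s t) p(t) dt`. -/
def laplaceT (p : ℝ → ℂ) (s : ℂ) : ℂ := ∫ t in Ioi (0 : ℝ), Complex.exp (-s * t) * p t

/-- Absolute convergence of the Laplace transform at `s`. -/
def LaplaceIntegrable (p : ℝ → ℂ) (s : ℂ) : Prop :=
  IntegrableOn (fun t : ℝ => Complex.exp (-s * t) * p t) (Ioi (0 : ℝ))

/-- The one-sided convolution `∫_0^t p(ξ) q(t - ξ) dξ`. -/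
def causalConv (p q : ℝ → ℂ) (t : ℝ) : ℂ := ∫ ξ in (0 : ℝ)..t, p ξ * q (t - ξ)

theorem LaplaceIntegrable.congr {p q : ℝ → ℂ} {s : ℂ} (hp : LaplaceIntegrable p s)
    (h : p =ᵐ[volume.restrict (Ioi 0)] q) : LaplaceIntegrable q s :=
  Integrable.congr hp (by filter_upwards [h] with t ht; rw [ht])

theorem laplaceT_congr {p q : ℝ → ℂ} {s : ℂ}
    (h : p =ᵐ[volume.restrict (Ioi 0)] q) : laplaceT p s = laplaceT q s :=
  integral_congr_ae (by filter_upwards [h] with t ht; rw [ht])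

theorem LaplaceIntegrable.congr_Ioi {p q : ℝ → ℂ} {s : ℂ} (hp : LaplaceIntegrable p s)
    (h : ∀ t, 0 < t → p t = q t) : LaplaceIntegrable q s :=
  hp.congr ((ae_restrict_iff' measurableSet_Ioi).2 (ae_of_all _ h))

theorem laplaceT_congr_Ioi {p q : ℝ → ℂ} {s : ℂ}
    (h : ∀ t, 0 < t → p t = q t) : laplaceT p s = laplaceT q s :=
  laplaceT_congr ((ae_restrict_iff' measurableSet_Ioi).2 (ae_of_all _ h))

theorem LaplaceIntegrable.add {p q : ℝ → ℂ} {s : ℂ} (hp : LaplaceIntegrable p s)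
    (hq : LaplaceIntegrable q s) : LaplaceIntegrable (fun t => p t + q t) s := by
  refine (Integrable.add hp hq).congr (ae_of_all _ fun t => ?_)
  simp [mul_add]

theorem laplaceT_add {p q : ℝ → ℂ} {s : ℂ} (hp : LaplaceIntegrable p s)
    (hq : LaplaceIntegrable q s) :
    laplaceT (fun t => p t + q t) s = laplaceT p s + laplaceT q s := by
  unfold laplaceT
  rw [← integral_add hp hq]
  simp [mul_add]

theorem LaplaceIntegrable.const_mul {p : ℝ → ℂ} {s : ℂ} (hp : LaplaceIntegrable p s) (c : ℂ) :
    LaplaceIntegrable (fun t => c * p t) s := by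
  refine (Integrable.const_mul hp c).congr (ae_of_all _ fun t => ?_)
  simp only; ring

theorem laplaceT_const_mul (p : ℝ → ℂ) (s c : ℂ) :
    laplaceT (fun t => c * p t) s = c * laplaceT p s := by
  unfold laplaceT
  rw [← integral_const_mul]
  congr 1; ext t; ring

theorem LaplaceIntegrable.sum {ι : Type*} (S : Finset ι) {p : ι → ℝ → ℂ} {s : ℂ}
    (hp : ∀ i ∈ S, LaplaceIntegrable (p i) s) : LaplaceIntegrable (fun t => ∑ i ∈ S, p i t) s := by
  refine (integrable_finsetSum S hp).congr (ae_of_all _ fun t => ?_)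
  simp [Finset.mul_sum]

theorem laplaceT_sum {ι : Type*} (S : Finset ι) {p : ι → ℝ → ℂ} {s : ℂ}
    (hp : ∀ i ∈ S, LaplaceIntegrable (p i) s) :
    laplaceT (fun t => ∑ i ∈ S, p i t) s = ∑ i ∈ S, laplaceT (p i) s := by
  unfold laplaceT
  rw [← integral_finsetSum S hp]
  simp [Finset.mul_sum]

theorem LaplaceIntegrable.locallyIntegrable {p : ℝ → ℂ} {s : ℂ} (hp : LaplaceIntegrable p s)
    (t : ℝ) : IntegrableOn p (Ioc 0 t) := by
  have h1 : IntegrableOn (fun t : ℝ => Complex.exp (-s * t) * p t) (Ioc 0 t) :=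
    IntegrableOn.mono_set hp Ioc_subset_Ioi_self
  have h2 := Integrable.bdd_mul (c := Real.exp (|s.re| * |t|)) (f := fun u : ℝ => Complex.exp (s * u))
    h1 (by fun_prop) ?_
  · refine h2.congr (ae_of_all _ fun u => ?_)
    simp only
    rw [← mul_assoc, ← Complex.exp_add]
    simp
  · rw [ae_restrict_iff' measurableSet_Ioc]
    refine ae_of_all _ fun u hu => ?_
    rw [Complex.norm_exp]
    refine Real.exp_le_exp.2 ?_
    have : |u| ≤ |t| := abs_le_abs_of_nonneg hu.1.le hu.2
    calc (s * u).re = s.re * u := by simp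
      _ ≤ |s.re * u| := le_abs_self _
      _ = |s.re| * |u| := abs_mul _ _
      _ ≤ _ := by gcongr

/-- The weight `exp(-s t)` is multiplicative over `t = ξ + (t - ξ)`, so weighting commutes with
convolution. This reduces the Laplace convolution theorem to the one for integrals of one-sided
convolutions. -/
theorem causalConv_exp (p q : ℝ → ℂ) (s : ℂ) (t : ℝ) :
    ∫ ξ in (0 : ℝ)..t, (ContinuousLinearMap.mul ℝ ℂ) (Complex.exp (-s * ξ) * p ξ)
      (Complex.exp (-s * (t - ξ : ℝ)) * q (t - ξ)) = Complex.exp (-s * t) * causalConv p q t := by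
  unfold causalConv
  rw [← intervalIntegral.integral_const_mul]
  congr 1; ext ξ
  have : Complex.exp (-s * t) = Complex.exp (-s * ξ) * Complex.exp (-s * (t - ξ : ℝ)) := by
    rw [← Complex.exp_add]; congr 1; push_cast; ring
  rw [this]
  simp only [ContinuousLinearMap.mul_apply']
  ring

theorem LaplaceIntegrable.causalConv {p q : ℝ → ℂ} {s : ℂ} (hp : LaplaceIntegrable p s)
    (hq : LaplaceIntegrable q s) : LaplaceIntegrable (causalConv p q) s := by
  have h := (integrable_posConvolution hp hq (ContinuousLinearMap.mul ℝ ℂ)).integrableOn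
    (s := Ioi (0 : ℝ))
  refine Integrable.congr h ?_
  rw [EventuallyEq, ae_restrict_iff' measurableSet_Ioi]
  refine ae_of_all _ fun t ht => ?_
  rw [posConvolution, indicator_of_mem ht, causalConv_exp]

theorem laplaceT_causalConv {p q : ℝ → ℂ} {s : ℂ} (hp : LaplaceIntegrable p s)
    (hq : LaplaceIntegrable q s) :
    laplaceT (causalConv p q) s = laplaceT p s * laplaceT q s := by
  have h := integral_posConvolution hp hq (ContinuousLinearMap.mul ℝ ℂ)
  simp_rw [causalConv_exp] at h
  exact h

/-! ### Laplace transforms of powers. -/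

theorem laplaceIntegrable_rpow {c : ℝ} (hc : 0 < c) {s : ℂ} (hs : 0 < s.re) :
    LaplaceIntegrable (fun t => ((t ^ (c - 1) : ℝ) : ℂ)) s := by
  have h := integrableOn_rpow_mul_exp_neg_mul_rpow (p := 1) (s := c - 1) (by linarith) one_pos hs
  refine Integrable.mono' h ?_ ?_
  · refine AEStronglyMeasurable.mul (by fun_prop) ?_
    exact (Complex.measurable_ofReal.comp (measurable_id.pow_const _)).aestronglyMeasurable
  · rw [ae_restrict_iff' measurableSet_Ioi]
    refine ae_of_all _ fun t ht => le_of_eq ?_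
    rw [norm_mul, Complex.norm_exp, Complex.norm_real, Real.norm_of_nonneg
      (Real.rpow_nonneg (le_of_lt ht) _), mul_comm]
    simp

/-- For real `s` this is the Gamma integral. Both sides are analytic on `Re s > 0`, the left one as
the complex moment generating function of `-t` under the measure `t^(c-1) dt`, so the identity
theorem extends the formula. -/
theorem laplaceT_rpow {c : ℝ} (hc : 0 < c) {s : ℂ} (hs : 0 < s.re) :
    laplaceT (fun t => ((t ^ (c - 1) : ℝ) : ℂ)) s = (Real.Gamma c : ℂ) * s ^ (-c : ℂ) := by
  set ν : Measure ℝ := (volume.restrict (Ioi 0)).withDensity (fun t => ENNReal.ofReal (t ^ (c - 1)))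
  have hmeas : Measurable fun t : ℝ => ENNReal.ofReal (t ^ (c - 1)) :=
    ENNReal.measurable_ofReal.comp (measurable_id.pow_const _)
  have hlt : ∀ᵐ t : ℝ ∂(volume.restrict (Ioi 0)), ENNReal.ofReal (t ^ (c - 1)) < ⊤ :=
    ae_of_all _ fun t => ENNReal.ofReal_lt_top
  have hM : ∀ z : ℂ, ProbabilityTheory.complexMGF (fun t : ℝ => -t) ν z =
      laplaceT (fun t => ((t ^ (c - 1) : ℝ) : ℂ)) z := by
    intro z
    rw [ProbabilityTheory.complexMGF, integral_withDensity_eq_integral_toReal_smul hmeas hlt]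
    refine setIntegral_congr_fun measurableSet_Ioi fun t ht => ?_
    simp only
    rw [ENNReal.toReal_ofReal (Real.rpow_nonneg (le_of_lt ht) _), Complex.real_smul, mul_comm]
    simp
  have hexp : Ioi (0 : ℝ) ⊆ ProbabilityTheory.integrableExpSet (fun t : ℝ => -t) ν := by
    intro r hr
    rw [ProbabilityTheory.integrableExpSet, mem_ofPred_eq,
      integrable_withDensity_iff_integrable_smul' hmeas hlt]
    have h := integrableOn_rpow_mul_exp_neg_mul_rpow (p := 1) (s := c - 1) (by linarith) one_pos hr
    refine Integrable.congr h ?_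
    rw [EventuallyEq, ae_restrict_iff' measurableSet_Ioi]
    refine ae_of_all _ fun t ht => ?_
    rw [ENNReal.toReal_ofReal (Real.rpow_nonneg (le_of_lt ht) _)]
    simp
  have hsub : {z : ℂ | 0 < z.re} ⊆
      {z | z.re ∈ interior (ProbabilityTheory.integrableExpSet (fun t : ℝ => -t) ν)} :=
    fun z hz => (interior_maximal hexp isOpen_Ioi) hz
  have hopen : IsOpen {z : ℂ | 0 < z.re} := isOpen_lt continuous_const Complex.continuous_re
  have hA1 : AnalyticOnNhd ℂ (laplaceT (fun t => ((t ^ (c - 1) : ℝ) : ℂ))) {z : ℂ | 0 < z.re} := by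
    rw [← funext hM]
    exact (ProbabilityTheory.differentiableOn_complexMGF.mono hsub).analyticOnNhd hopen
  have hA2 : AnalyticOnNhd ℂ (fun z : ℂ => (Real.Gamma c : ℂ) * z ^ (-c : ℂ))
      {z : ℂ | 0 < z.re} := by
    refine DifferentiableOn.analyticOnNhd (fun z hz => ?_) hopen
    exact ((differentiableAt_id.cpow_const (Or.inl hz)).const_mul _).differentiableWithinAt
  have hconv : IsPreconnected {z : ℂ | 0 < z.re} :=
    (convex_halfSpace_re_gt 0).isPreconnected
  have hreal : ∀ r : ℝ, 0 < r → laplaceT (fun t => ((t ^ (c - 1) : ℝ) : ℂ)) (r : ℂ) =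
      (Real.Gamma c : ℂ) * (r : ℂ) ^ (-c : ℂ) := by
    intro r hr
    have h := Real.integral_rpow_mul_exp_neg_mul_Ioi hc hr
    rw [one_div, Real.inv_rpow hr.le, ← Real.rpow_neg hr.le, mul_comm] at h
    have h' := congrArg ((↑) : ℝ → ℂ) h
    rw [← integral_complex_ofReal, Complex.ofReal_mul, Complex.ofReal_cpow hr.le] at h'
    rw [← Complex.ofReal_neg, ← h']
    refine setIntegral_congr_fun measurableSet_Ioi fun t ht => ?_
    push_cast
    ring_nf
  refine hA1.eqOn_of_preconnected_of_frequently_eq hA2 hconv (z₀ := 1) (by simp) ?_ hs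
  -- The real points `1 + 1/(n+1)` accumulate at `1`, which is enough for the identity theorem.
  have ht : Tendsto (fun n : ℕ => ((1 + 1 / ((n : ℝ) + 1) : ℝ) : ℂ)) atTop (𝓝[≠] 1) := by
    refine tendsto_nhdsWithin_iff.2 ⟨?_, Eventually.of_forall fun n => ?_⟩
    · have := (tendsto_one_div_add_atTop_nhds_zero_nat (𝕜 := ℝ)).const_add 1
      rw [add_zero] at this
      have h2 := (Complex.continuous_ofReal.tendsto 1).comp this
      rwa [Complex.ofReal_one] at h2
    · have : (0 : ℝ) < 1 / ((n : ℝ) + 1) := by positivity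
      intro h
      have h' : (1 + 1 / ((n : ℝ) + 1) : ℝ) = 1 := Complex.ofReal_injective h
      linarith
  exact ht.frequently (Frequently.of_forall fun n => hreal _ (by positivity))

/-! ### Injectivity of the Fourier and Laplace transforms. -/

/-- Every test function is the Fourier transform of a Schwartz function `H`, and moving the
transform from `H` onto `f` gives `∫ g f = ∫ H f^ = 0`. -/
theorem ae_eq_zero_of_fourier_eq_zero {f : ℝ → ℂ} (hf : Integrable f)
    (h : ∀ w : ℝ, FourierTransform.fourier f w = 0) : f =ᵐ[volume] 0 := by
  refine ae_eq_zero_of_integral_contDiff_smul_eq_zero hf.locallyIntegrable ?_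
  intro g hg hgc
  have hgc' : HasCompactSupport (fun x => (g x : ℂ)) := hgc.comp_left Complex.ofReal_zero
  have hg' : ContDiff ℝ ((⊤ : ℕ∞) : WithTop ℕ∞) (fun x => (g x : ℂ)) :=
    Complex.ofRealCLM.contDiff.comp hg
  let G : SchwartzMap ℝ ℂ := hgc'.toSchwartzMap hg'
  let H : SchwartzMap ℝ ℂ := FourierTransformInv.fourierInv G
  have hH : FourierTransform.fourier H = G := FourierTransform.fourier_fourierInv_eq G
  have key := VectorFourier.integral_fourierIntegral_smul_eq_flip (μ := volume) (ν := volume)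
    (L := innerₗ ℝ) (f := (H : ℝ → ℂ)) (g := f)
      Real.continuous_fourierChar continuous_inner H.integrable hf
  have e1 : ∀ ξ : ℝ, VectorFourier.fourierIntegral Real.fourierChar volume (innerₗ ℝ) (H : ℝ → ℂ) ξ
      = (g ξ : ℂ) := by
    intro ξ
    have : FourierTransform.fourier (H : ℝ → ℂ) ξ = G ξ := by
      rw [← SchwartzMap.fourier_coe, hH]
    exact this
  have e2 : ∀ ξ : ℝ, VectorFourier.fourierIntegral Real.fourierChar volume (innerₗ ℝ).flip f ξ
      = 0 := by
    intro ξ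
    rw [flip_innerₗ]
    exact h ξ
  simp only [e1, e2, smul_zero, integral_zero] at key
  rw [← key]
  rfl

/-- A function whose Laplace transform vanishes on a half-plane is zero almost everywhere. -/
theorem ae_eq_zero_of_laplaceT_eq_zero {p : ℝ → ℂ} {σ : ℝ}
    (hp : LaplaceIntegrable p σ) (h : ∀ s : ℂ, s.re = σ → laplaceT p s = 0) :
    p =ᵐ[volume.restrict (Ioi 0)] 0 := by
  set f : ℝ → ℂ := indicator (Ioi 0) (fun t : ℝ => Complex.exp (-(σ : ℂ) * t) * p t) with hf
  have hfi : Integrable f := (integrable_indicator_iff measurableSet_Ioi).2 hp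
  have hz : f =ᵐ[volume] 0 := by
    refine ae_eq_zero_of_fourier_eq_zero hfi fun w => ?_
    rw [Real.fourier_real_eq_integral_exp_smul]
    -- On the line `Re s = σ` the Laplace transform is the Fourier transform of `exp(-σ t) p(t)`
    -- extended by zero; only this line is needed.
    have := h (σ + (2 * Real.pi * w : ℝ) * Complex.I) (by simp)
    rw [laplaceT, ← integral_indicator measurableSet_Ioi] at this
    rw [← this]
    congr 1; ext t
    by_cases ht : t ∈ Ioi (0 : ℝ)
    · rw [hf, indicator_of_mem ht, indicator_of_mem ht, smul_eq_mul, ← mul_assoc,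
        ← Complex.exp_add]
      congr 2
      push_cast
      ring
    · rw [hf, indicator_of_notMem ht, indicator_of_notMem ht, smul_zero]
  rw [EventuallyEq, ae_restrict_iff' measurableSet_Ioi]
  filter_upwards [hz] with t ht htm
  rw [hf, indicator_of_mem htm] at ht
  simpa using ht

/-! ### Gamma bound and the double binomial series. -/

/-- The lower bound `Γ(x) ≥ R^x exp(-2R) / 2`. -/
theorem rpow_mul_exp_le_Gamma {x R : ℝ} (hx : 0 < x) (hR : 0 < R) :
    R ^ x * Real.exp (-(2 * R)) / 2 ≤ Real.Gamma x := by
  rw [Real.Gamma_eq_integral hx]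
  have hi := Real.GammaIntegral_convergent hx
  have hsub : Ioc R (2 * R) ⊆ Ioi 0 := fun t ht => hR.trans ht.1
  have h1 : ∫ t in Ioc R (2 * R), Real.exp (-t) * t ^ (x - 1) ≤
      ∫ t in Ioi 0, Real.exp (-t) * t ^ (x - 1) := by
    refine setIntegral_mono_set hi ?_ hsub.eventuallyLE
    rw [EventuallyLE, ae_restrict_iff' measurableSet_Ioi]
    exact ae_of_all _ fun t ht => mul_nonneg (Real.exp_nonneg _) (Real.rpow_nonneg (le_of_lt ht) _)
  -- On `(R, 2R]` the Gamma integrand is at least `exp(-2R) R^x / (2R)`; the length `R` of the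
  -- interval leaves the factor `1/2`.
  have h2 : ∫ t in Ioc R (2 * R), Real.exp (-(2 * R)) * (R ^ x / (2 * R)) ≤
      ∫ t in Ioc R (2 * R), Real.exp (-t) * t ^ (x - 1) := by
    refine setIntegral_mono_on continuous_const.integrableOn_Ioc (hi.mono_set hsub) measurableSet_Ioc fun t ht => ?_
    have ht0 : 0 < t := hsub ht
    rw [Real.rpow_sub_one ht0.ne']
    have h3 : R ^ x ≤ t ^ x := Real.rpow_le_rpow hR.le ht.1.le hx.le
    have h4 : R ^ x / (2 * R) ≤ t ^ x / t := by
      have := Real.rpow_nonneg hR.le x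
      exact div_le_div₀ (this.trans h3) h3 ht0 ht.2
    have h5 : Real.exp (-(2 * R)) ≤ Real.exp (-t) := Real.exp_le_exp.2 (by linarith [ht.2])
    have := Real.rpow_nonneg hR.le x
    gcongr
  refine le_trans (le_of_eq ?_) (h2.trans h1)
  rw [setIntegral_const]
  simp only [Measure.real, Real.volume_Ioc, smul_eq_mul]
  rw [ENNReal.toReal_ofReal (by linarith)]
  field_simp
  ring

/-- Summing over the exponent of `y` is a negative binomial series with value `1/(1-y)^(r+1)`. What
remains is geometric with ratio `x/(1-y)`, which is below `1` exactly when `x + y < 1`. -/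
theorem summable_choose_mul_pow_mul_pow {x y : ℝ} (hx : 0 ≤ x) (hy : 0 ≤ y) (h : x + y < 1) :
    Summable fun p : ℕ × ℕ => ((p.2 + p.1).choose p.1 : ℝ) * y ^ p.2 * x ^ p.1 := by
  have hy1 : ‖y‖ < 1 := by rw [Real.norm_of_nonneg hy]; linarith
  have key : ∀ r : ℕ, HasSum (fun m : ℕ => ((m + r).choose r : ℝ) * y ^ m * x ^ r)
      (1 / (1 - y) ^ (r + 1) * x ^ r) := fun r =>
    (hasSum_choose_mul_geometric_of_norm_lt_one r hy1).mul_right _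
  refine (summable_prod_of_nonneg fun p => by dsimp; positivity).2 ⟨fun r => (key r).summable, ?_⟩
  simp only [(key _).tsum_eq]
  have h1 : 0 < 1 - y := by linarith
  have : Summable fun r : ℕ => 1 / (1 - y) * (x / (1 - y)) ^ r :=
    (summable_geometric_of_lt_one (by positivity) ((div_lt_one h1).2 (by linarith))).mul_left _
  refine this.congr fun r => ?_
  rw [div_pow, pow_succ]
  field_simp

theorem hasSum_choose_mul_pow_mul_pow {x y : ℂ} (h : ‖x‖ + ‖y‖ < 1) :
    HasSum (fun p : ℕ × ℕ => ((p.2 + p.1).choose p.1 : ℂ) * y ^ p.2 * x ^ p.1)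
      (1 / (1 - x - y)) := by
  have hs : Summable (fun p : ℕ × ℕ => ((p.2 + p.1).choose p.1 : ℂ) * y ^ p.2 * x ^ p.1) := by
    refine Summable.of_norm ?_
    refine (summable_choose_mul_pow_mul_pow (norm_nonneg x) (norm_nonneg y) h).congr fun p => ?_
    simp
  have hy1 : ‖y‖ < 1 := by linarith [norm_nonneg x]
  have key : ∀ r : ℕ, HasSum (fun m : ℕ => ((m + r).choose r : ℂ) * y ^ m * x ^ r)
      (1 / (1 - y) ^ (r + 1) * x ^ r) := fun r =>
    (hasSum_choose_mul_geometric_of_norm_lt_one r hy1).mul_right _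
  have h1 := hs.hasSum.prod_fiberwise key
  have hne : 1 - y ≠ 0 := by
    intro h0
    have : y = 1 := (sub_eq_zero.1 h0).symm
    rw [this] at hy1; simp at hy1
  have hlt : ‖x / (1 - y)‖ < 1 := by
    have : 1 - ‖y‖ ≤ ‖1 - y‖ := by simpa using norm_sub_norm_le (1 : ℂ) y
    rw [norm_div, div_lt_one (norm_pos_iff.2 hne)]
    linarith
  have hne' : 1 - x - y ≠ 0 := by
    intro h0
    have h2 : x + y = 1 := by linear_combination -h0
    have h3 := norm_add_le x y
    rw [h2, norm_one] at h3
    linarith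
  have h2 : HasSum (fun r : ℕ => 1 / (1 - y) ^ (r + 1) * x ^ r) (1 / (1 - x - y)) := by
    convert! (hasSum_geometric_of_norm_lt_one hlt).mul_left (1 / (1 - y)) using 1
    · ext r; rw [div_pow, pow_succ]; field_simp
    · have : 1 - x / (1 - y) = (1 - x - y) / (1 - y) := by field_simp; ring
      rw [this]; field_simp
  rw [← h1.unique h2]
  exact hs.hasSum

/-- For `ρ` large, `A ρ^(-δ) + B ρ^(-α) < 1`. -/
theorem exists_forall_rpow_add_rpow_lt_one {α δ : ℝ} (hα : 0 < α) (hδ : 0 < δ) (A B : ℝ) :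
    ∃ σ : ℝ, 1 ≤ σ ∧ ∀ ρ : ℝ, σ < ρ → A * ρ ^ (-δ) + B * ρ ^ (-α) < 1 := by
  have h : Tendsto (fun ρ : ℝ => A * ρ ^ (-δ) + B * ρ ^ (-α)) atTop (𝓝 0) := by
    simpa using ((tendsto_rpow_neg_atTop hδ).const_mul A).add
      ((tendsto_rpow_neg_atTop hα).const_mul B)
  obtain ⟨σ, hσ⟩ := eventually_atTop.1 (h.eventually (gt_mem_nhds one_pos))
  exact ⟨max 1 σ, le_max_left _ _, fun ρ hρ => hσ ρ ((le_max_right _ _).trans hρ.le)⟩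

/-! ### Convergence and continuity of the series `S_κ`. -/

/-- The terms of the double series obtained by expanding the Prabhakar functions in
`mlSeries`. -/
def mlDouble (α β a κ : ℝ) (b : ℂ) (t : ℝ) (p : ℕ × ℕ) : ℂ :=
  ((-a : ℝ) : ℂ) ^ p.1 * ((t ^ ((α - β) * p.1) : ℝ) : ℂ) *
    prabhakarTerm (p.1 + 1) α (κ + (α - β) * p.1) (-b * ((t ^ α : ℝ) : ℂ)) p.2

/-- For the integer parameter `c = r + 1`, `(c)_m / m!` is the binomial coefficient of the negative
binomial series. -/
theorem prabhakarTerm_nat (r : ℕ) (α κ : ℝ) (z : ℂ) (m : ℕ) :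
    prabhakarTerm (r + 1) α κ z m =
      ((m + r).choose r : ℂ) * z ^ m / (Real.Gamma (α * m + κ) : ℂ) := by
  have h1 : (ascPochhammer ℝ m).eval ((r : ℝ) + 1) = (m.factorial : ℝ) * ((m + r).choose r : ℝ) := by
    have h := Nat.ascFactorial_eq_factorial_mul_choose r m
    have h2 : (r + m).choose m = (m + r).choose r := by
      rw [add_comm]; exact Nat.choose_symm_add
    rw [← Nat.cast_add_one, ← Nat.cast_ascFactorial, h, h2]
    push_cast; rfl
  have h3 : (m.factorial : ℝ) ≠ 0 := by exact_mod_cast m.factorial_ne_zero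
  rw [prabhakarTerm, h1, mul_comm (Real.Gamma _), mul_div_mul_left _ _ h3]
  push_cast
  ring

section

variable {α β a κ : ℝ}

theorem mlDouble_exponent_pos (hα : 0 < α) (hβ : β < α) (hκ : 0 < κ) (p : ℕ × ℕ) :
    0 < α * p.2 + (κ + (α - β) * p.1) := by
  have : 0 ≤ α * (p.2 : ℝ) := by positivity
  have : 0 ≤ (α - β) * (p.1 : ℝ) := mul_nonneg (by linarith) (by positivity)
  linarith

theorem norm_mlDouble (hα : 0 < α) (hβ : β < α) (hκ : 0 < κ) (b : ℂ) {t : ℝ} (ht : 0 ≤ t)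
    (p : ℕ × ℕ) : ‖mlDouble α β a κ b t p‖ =
      ((p.2 + p.1).choose p.1 : ℝ) * (‖b‖ * t ^ α) ^ p.2 * (|a| * t ^ (α - β)) ^ p.1 /
        Real.Gamma (α * p.2 + (κ + (α - β) * p.1)) := by
  have hΓ := Real.Gamma_pos_of_pos (mlDouble_exponent_pos hα hβ hκ p)
  rw [mlDouble, prabhakarTerm_nat]
  simp only [norm_mul, norm_div, norm_pow, Complex.norm_real, Complex.norm_natCast, norm_neg,
    Real.norm_eq_abs]
  rw [abs_of_nonneg (Real.rpow_nonneg ht _), abs_of_nonneg (Real.rpow_nonneg ht _),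
    abs_of_pos hΓ, Real.rpow_mul ht, Real.rpow_natCast, mul_pow |a|]
  ring

/-- The values at the right endpoint `T` serve as a Weierstrass majorant on `[0, T]`, giving
continuity and dominated convergence later. -/
theorem norm_mlDouble_mono (hα : 0 < α) (hβ : β < α) (hκ : 0 < κ) (b : ℂ) {t T : ℝ}
    (ht : 0 ≤ t) (hT : t ≤ T) (p : ℕ × ℕ) :
    ‖mlDouble α β a κ b t p‖ ≤ ‖mlDouble α β a κ b T p‖ := by
  have hΓ := Real.Gamma_pos_of_pos (mlDouble_exponent_pos hα hβ hκ p)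
  rw [norm_mlDouble hα hβ hκ b ht, norm_mlDouble hα hβ hκ b (ht.trans hT)]
  have h1 : t ^ α ≤ T ^ α := Real.rpow_le_rpow ht hT hα.le
  have h2 : t ^ (α - β) ≤ T ^ (α - β) := Real.rpow_le_rpow ht hT (by linarith)
  have h3 := Real.rpow_nonneg ht α
  have h4 := Real.rpow_nonneg ht (α - β)
  have h5 := h3.trans h1
  gcongr

theorem summable_mlDouble_of_pos (hα : 0 < α) (hβ : β < α) (hκ : 0 < κ) (b : ℂ) {t : ℝ}
    (ht : 0 < t) : Summable fun p => ‖mlDouble α β a κ b t p‖ := by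
  have hδ : 0 < α - β := by linarith
  obtain ⟨σ, hσ1, hσ⟩ := exists_forall_rpow_add_rpow_lt_one hα hδ |a| ‖b‖
  set ρ := σ + 1 with hρ
  have hρ0 : 0 < ρ := by linarith
  have hlt := hσ ρ (by linarith)
  -- With this `R` the Gamma bound replaces `t^c` by `t^c R^(-c) = ρ^(-c)`, up to constants
  -- independent of `p`. The choice of `ρ` makes the resulting binomial series converge.
  set R := ρ * t with hR
  have hR0 : 0 < R := by positivity
  have hs := (summable_choose_mul_pow_mul_pow (x := |a| * ρ ^ (-(α - β))) (y := ‖b‖ * ρ ^ (-α))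
    (by positivity) (by positivity) hlt).mul_left (2 * Real.exp (2 * R) * R ^ (-κ))
  refine Summable.of_nonneg_of_le (fun p => norm_nonneg _) (fun p => ?_) hs
  rw [norm_mlDouble hα hβ hκ b ht.le]
  have hx := mlDouble_exponent_pos hα hβ hκ p
  have hΓ := Real.Gamma_pos_of_pos hx
  have hb := rpow_mul_exp_le_Gamma hx hR0
  rw [div_le_iff₀ hΓ]
  have e1 : R ^ (α * p.2 + (κ + (α - β) * p.1)) = R ^ κ * (R ^ α) ^ p.2 * (R ^ (α - β)) ^ p.1 := by
    rw [Real.rpow_add hR0, Real.rpow_add hR0, Real.rpow_mul hR0.le, Real.rpow_mul hR0.le,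
      Real.rpow_natCast, Real.rpow_natCast]
    ring
  have e2 : ∀ c : ℝ, ρ ^ (-c) * R ^ c = t ^ c := by
    intro c
    rw [hR, Real.mul_rpow hρ0.le ht.le, ← mul_assoc, ← Real.rpow_add hρ0]
    simp
  have e3 : R ^ (-κ) * R ^ κ = 1 := by rw [← Real.rpow_add hR0]; simp
  have e4 : Real.exp (2 * R) * Real.exp (-(2 * R)) = 1 := by rw [← Real.exp_add]; simp
  refine le_trans (le_of_eq ?_) (mul_le_mul_of_nonneg_left hb (by positivity))
  rw [e1]
  have e5 : (‖b‖ * t ^ α) ^ p.2 = (‖b‖ * ρ ^ (-α)) ^ p.2 * (R ^ α) ^ p.2 := by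
    rw [← mul_pow, mul_assoc, e2]
  have e6 : (|a| * t ^ (α - β)) ^ p.1 = (|a| * ρ ^ (-(α - β))) ^ p.1 * (R ^ (α - β)) ^ p.1 := by
    rw [← mul_pow, mul_assoc, e2]
  rw [e5, e6]
  have e7 : R ^ (-κ) * R ^ κ * (Real.exp (2 * R) * Real.exp (-(2 * R))) = 1 := by
    rw [e3, e4, one_mul]
  linear_combination (-((p.2 + p.1).choose p.1 : ℝ) * ((‖b‖ * ρ ^ (-α)) ^ p.2 * (R ^ α) ^ p.2)
    * ((|a| * ρ ^ (-(α - β))) ^ p.1 * (R ^ (α - β)) ^ p.1)) * e7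

theorem summable_norm_mlDouble (hα : 0 < α) (hβ : β < α) (hκ : 0 < κ) (b : ℂ) {t : ℝ}
    (ht : 0 ≤ t) : Summable fun p => ‖mlDouble α β a κ b t p‖ :=
  Summable.of_nonneg_of_le (fun p => norm_nonneg _)
    (fun p => norm_mlDouble_mono hα hβ hκ b ht (by linarith : t ≤ t + 1) p)
    (summable_mlDouble_of_pos hα hβ hκ b (by linarith))

theorem summable_mlDouble (hα : 0 < α) (hβ : β < α) (hκ : 0 < κ) (b : ℂ) {t : ℝ}
    (ht : 0 ≤ t) : Summable (mlDouble α β a κ b t) :=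
  (summable_norm_mlDouble hα hβ hκ b ht).of_norm

theorem summable_prabhakarTerm (hα : 0 < α) (hβ : β < α) (hκ : 0 < κ) (b : ℂ) {t : ℝ}
    (ht : 0 < t) (r : ℕ) : Summable
      (prabhakarTerm (r + 1) α (κ + (α - β) * r) (-b * ((t ^ α : ℝ) : ℂ))) := by
  -- The Prabhakar terms do not involve `a`; taking `a = 1` makes the prefactor `(-a)^r` nonzero, so
  -- that it can be divided out.
  have h := (summable_mlDouble (a := 1) hα hβ hκ b ht.le).prod_factor r
  have h' : Summable fun m => ((-(1 : ℝ) : ℝ) : ℂ) ^ r * ((t ^ ((α - β) * r) : ℝ) : ℂ) *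
    prabhakarTerm (r + 1) α (κ + (α - β) * r) (-b * ((t ^ α : ℝ) : ℂ)) m := h
  rw [summable_mul_left_iff] at h'
  · exact h'
  refine mul_ne_zero (pow_ne_zero _ (by norm_num)) ?_
  exact_mod_cast (Real.rpow_pos_of_pos ht _).ne'

theorem tsum_mlDouble_snd (α β a κ : ℝ) (b : ℂ) (t : ℝ) (r : ℕ) :
    ∑' m, mlDouble α β a κ b t (r, m) = mlTerm α β a κ b t r := by
  simp only [mlDouble, mlTerm, prabhakar, tsum_mul_left]

theorem summable_norm_mlTerm (hα : 0 < α) (hβ : β < α) (hκ : 0 < κ) (b : ℂ) {t : ℝ}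
    (ht : 0 ≤ t) : Summable fun r => ‖mlTerm α β a κ b t r‖ := by
  have h := summable_norm_mlDouble (a := a) hα hβ hκ b ht
  refine Summable.of_nonneg_of_le (fun _ => norm_nonneg _) (fun r => ?_) h.prod
  rw [← tsum_mlDouble_snd]
  exact norm_tsum_le_tsum_norm (h.prod_factor r)

theorem mlSeries_eq_tsum_mlDouble (hα : 0 < α) (hβ : β < α) (hκ : 0 < κ) (b : ℂ) {t : ℝ}
    (ht : 0 ≤ t) : mlSeries α β a κ b t = ∑' p, mlDouble α β a κ b t p := by
  rw [(summable_mlDouble hα hβ hκ b ht).tsum_prod]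
  simp_rw [tsum_mlDouble_snd]
  rfl

/-- A bound for the sum of the norms of the terms of `mlSeries`, uniform on `[0, T]`. -/
theorem exists_tsum_norm_mlTerm_le (hα : 0 < α) (hβ : β < α) (hκ : 0 < κ) (b : ℂ) (T : ℝ) :
    ∃ u : ℕ → ℝ, Summable u ∧ ∀ t r, 0 ≤ t → t ≤ T → ‖mlTerm α β a κ b t r‖ ≤ u r := by
  have h := summable_norm_mlDouble (a := a) hα hβ hκ b (abs_nonneg T)
  refine ⟨_, h.prod, fun t r ht hT => ?_⟩
  have hle := fun m => norm_mlDouble_mono (a := a) hα hβ hκ b ht (hT.trans (le_abs_self T)) (r, m)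
  have h1 : Summable fun m => ‖mlDouble α β a κ b t (r, m)‖ :=
    Summable.of_nonneg_of_le (fun _ => norm_nonneg _) hle (h.prod_factor r)
  rw [← tsum_mlDouble_snd]
  exact (norm_tsum_le_tsum_norm h1).trans (h1.tsum_le_tsum hle (h.prod_factor r))

theorem continuous_mlDouble (hα : 0 < α) (hβ : β < α) (b : ℂ) (p : ℕ × ℕ) :
    Continuous fun t => mlDouble α β a κ b t p := by
  have h1 : Continuous fun t : ℝ => t ^ α :=
    Continuous.rpow_const continuous_id fun _ => Or.inr hα.le
  have h2 : Continuous fun t : ℝ => t ^ ((α - β) * (p.1 : ℝ)) :=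
    Continuous.rpow_const continuous_id fun _ => Or.inr
      (mul_nonneg (by linarith) (Nat.cast_nonneg _))
  unfold mlDouble prabhakarTerm
  fun_prop

theorem continuousOn_mlTerm (hα : 0 < α) (hβ : β < α) (hκ : 0 < κ) (b : ℂ) (r : ℕ) :
    ContinuousOn (fun t => mlTerm α β a κ b t r) (Ici 0) := by
  intro x hx
  have h := (summable_norm_mlDouble (a := a) hα hβ hκ b (t := x + 1)
    (by linarith [mem_Ici.1 hx])).prod_factor r
  have h1 : ContinuousOn (fun t => ∑' m, mlDouble α β a κ b t (r, m)) (Icc 0 (x + 1)) :=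
    continuousOn_tsum (fun m => (continuous_mlDouble hα hβ b (r, m)).continuousOn) h
      fun m t ht => norm_mlDouble_mono hα hβ hκ b ht.1 ht.2 _
  simp_rw [tsum_mlDouble_snd] at h1
  refine (h1 x ⟨hx, by linarith⟩).mono_of_mem_nhdsWithin ?_
  rw [← Ici_inter_Iic]
  exact inter_mem_nhdsWithin _ (Iic_mem_nhds (by linarith))

theorem continuousOn_mlSeries (hα : 0 < α) (hβ : β < α) (hκ : 0 < κ) (b : ℂ) :
    ContinuousOn (mlSeries α β a κ b) (Ici 0) := by
  intro x hx
  obtain ⟨u, hu, hle⟩ := exists_tsum_norm_mlTerm_le (a := a) hα hβ hκ b (x + 1)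
  have h1 : ContinuousOn (mlSeries α β a κ b) (Icc 0 (x + 1)) :=
    continuousOn_tsum (fun r => (continuousOn_mlTerm hα hβ hκ b r).mono Icc_subset_Ici_self) hu
      fun r t ht => hle t r ht.1 ht.2
  refine (h1 x ⟨hx, by linarith⟩).mono_of_mem_nhdsWithin ?_
  rw [← Ici_inter_Iic]
  exact inter_mem_nhdsWithin _ (Iic_mem_nhds (by linarith))

/-! ### Laplace transform of `t^(κ-1) S_κ`. -/

/-- The coefficient of `t^(κ - 1 + (α - β) r + α m)` in `t^(κ - 1) * mlSeries`. -/
def mlCoeff (α β a κ : ℝ) (b : ℂ) (p : ℕ × ℕ) : ℂ :=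
  ((p.2 + p.1).choose p.1 : ℂ) * (-b) ^ p.2 * (-a : ℂ) ^ p.1 /
    (Real.Gamma (α * p.2 + (κ + (α - β) * p.1)) : ℂ)

theorem rpow_mul_mlDouble (b : ℂ) {t : ℝ} (ht : 0 < t) (p : ℕ × ℕ) :
    ((t ^ (κ - 1) : ℝ) : ℂ) * mlDouble α β a κ b t p =
      mlCoeff α β a κ b p * ((t ^ (α * p.2 + (κ + (α - β) * p.1) - 1) : ℝ) : ℂ) := by
  have e : t ^ (α * p.2 + (κ + (α - β) * p.1) - 1) =
      t ^ (κ - 1) * t ^ ((α - β) * p.1) * (t ^ α) ^ p.2 := by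
    rw [← Real.rpow_natCast, ← Real.rpow_mul ht.le, ← Real.rpow_add ht, ← Real.rpow_add ht]
    congr 1; ring
  rw [mlDouble, prabhakarTerm_nat, mlCoeff, e, mul_pow]
  push_cast
  ring

theorem rpow_mul_mlSeries (hα : 0 < α) (hβ : β < α) (hκ : 0 < κ) (b : ℂ) {t : ℝ} (ht : 0 < t) :
    HasSum (fun p : ℕ × ℕ => mlCoeff α β a κ b p *
      ((t ^ (α * p.2 + (κ + (α - β) * p.1) - 1) : ℝ) : ℂ))
      (((t ^ (κ - 1) : ℝ) : ℂ) * mlSeries α β a κ b t) := by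
  rw [mlSeries_eq_tsum_mlDouble hα hβ hκ b ht.le]
  have h := (summable_mlDouble (a := a) hα hβ hκ b ht.le).hasSum.mul_left ((t ^ (κ - 1) : ℝ) : ℂ)
  simpa only [rpow_mul_mlDouble b ht] using h

end

/-- The norm of the sum is at most the sum of the norms, whose integral is finite by Tonelli. It
serves both the Laplace integral and the `(ξ, k)` integral of part 5. -/
theorem integrable_of_hasSum {X ι E : Type*} [MeasurableSpace X] {ν : Measure X} [Countable ι]
    [NormedAddCommGroup E] {F : ι → X → E} {f : X → E}
    (hF : ∀ i, Integrable (F i) ν) (hs : Summable fun i => ∫ x, ‖F i x‖ ∂ν)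
    (h : ∀ᵐ x ∂ν, HasSum (fun i => F i x) (f x)) : Integrable f ν := by
  refine ⟨aestronglyMeasurable_of_tendsto_ae atTop
    (fun S : Finset ι => (integrable_finsetSum S fun i _ => hF i).aestronglyMeasurable) h, ?_⟩
  have e : ∀ i, ∫⁻ x, ‖F i x‖ₑ ∂ν = ENNReal.ofReal (∫ x, ‖F i x‖ ∂ν) := fun i =>
    (ofReal_integral_norm_eq_lintegral_enorm (hF i)).symm
  have h1 : ∫⁻ x, ‖f x‖ₑ ∂ν ≤ ∑' i, ∫⁻ x, ‖F i x‖ₑ ∂ν := by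
    rw [← lintegral_tsum fun i => (hF i).aestronglyMeasurable.enorm]
    refine lintegral_mono_ae ?_
    filter_upwards [h] with x hx
    exact hx.tsum_eq ▸ enorm_tsum_le_tsum_enorm
  refine lt_of_le_of_lt h1 ?_
  simp_rw [e]
  exact hs.tsum_ofReal_lt_top

section

variable {α β a κ : ℝ}

/-- A real exponent contributes no factor from the argument of `s`, and `Re s ≤ |s|`. Smallness
conditions can thus be stated in `s.re` alone. -/
theorem norm_cpow_neg_le {s : ℂ} (hs : 0 < s.re) {c : ℝ} (hc : 0 ≤ c) :
    ‖s ^ (-(c : ℂ))‖ ≤ s.re ^ (-c) := by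
  rw [← Complex.ofReal_neg, Complex.norm_cpow_real]
  exact Real.rpow_le_rpow_of_nonpos hs (Complex.re_le_norm s) (by linarith)

theorem cpow_exponent {s : ℂ} (hs : 0 < s.re) (α β κ : ℝ) (p : ℕ × ℕ) :
    s ^ (-((α * p.2 + (κ + (α - β) * p.1) : ℝ) : ℂ)) =
      s ^ (-(κ : ℂ)) * (s ^ (-(α : ℂ))) ^ p.2 * (s ^ (-((α - β : ℝ) : ℂ))) ^ p.1 := by
  have hs0 : s ≠ 0 := by rintro rfl; simp at hs
  rw [← Complex.cpow_mul_nat, ← Complex.cpow_mul_nat, ← Complex.cpow_add _ _ hs0,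
    ← Complex.cpow_add _ _ hs0]
  congr 1
  push_cast
  ring

theorem rpow_exponent {s : ℝ} (hs : 0 < s) (α β κ : ℝ) (p : ℕ × ℕ) :
    s ^ (-(α * p.2 + (κ + (α - β) * p.1))) =
      s ^ (-κ) * (s ^ (-α)) ^ p.2 * (s ^ (-(α - β))) ^ p.1 := by
  rw [← Real.rpow_mul_natCast hs.le, ← Real.rpow_mul_natCast hs.le, ← Real.rpow_add hs,
    ← Real.rpow_add hs]
  congr 1
  ring

/-- The Laplace transform of `t^(κ-1) * mlSeries`, as a geometric series. -/
theorem laplaceT_rpow_mul_mlSeries (hα : 0 < α) (hβ : β < α) (hκ : 0 < κ) (b : ℂ) {s : ℂ}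
    (hs : 0 < s.re) (hlt : |a| * s.re ^ (-(α - β)) + ‖b‖ * s.re ^ (-α) < 1) :
    LaplaceIntegrable (fun t => ((t ^ (κ - 1) : ℝ) : ℂ) * mlSeries α β a κ b t) s ∧
    laplaceT (fun t => ((t ^ (κ - 1) : ℝ) : ℂ) * mlSeries α β a κ b t) s =
      s ^ (-(κ : ℂ)) * (1 / (1 + a * s ^ (-((α - β : ℝ) : ℂ)) + b * s ^ (-(α : ℂ)))) := by
  set F : ℕ × ℕ → ℝ → ℂ := fun p t => Complex.exp (-s * t) * (mlCoeff α β a κ b p *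
      ((t ^ (α * p.2 + (κ + (α - β) * p.1) - 1) : ℝ) : ℂ)) with hF
  have hx := mlDouble_exponent_pos hα hβ hκ
  have hint : ∀ p, IntegrableOn (F p) (Ioi 0) := fun p =>
    (laplaceIntegrable_rpow (hx p) hs).const_mul _
  have hval : ∀ p : ℕ × ℕ, ∫ t in Ioi 0, F p t = s ^ (-(κ : ℂ)) *
      (((p.2 + p.1).choose p.1 : ℂ) * (-(b * s ^ (-(α : ℂ)))) ^ p.2 *
        (-(a * s ^ (-((α - β : ℝ) : ℂ)))) ^ p.1) := by
    intro p
    have h1 : ∫ t in Ioi 0, F p t = _ :=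
      laplaceT_const_mul (fun t => ((t ^ (α * p.2 + (κ + (α - β) * p.1) - 1) : ℝ) : ℂ)) s
        (mlCoeff α β a κ b p)
    have hΓ : (Real.Gamma (α * p.2 + (κ + (α - β) * p.1)) : ℂ) ≠ 0 := by
      exact_mod_cast (Real.Gamma_pos_of_pos (hx p)).ne'
    rw [h1, laplaceT_rpow (hx p) hs, cpow_exponent hs, mlCoeff, neg_mul_eq_neg_mul, mul_pow,
      neg_mul_eq_neg_mul, mul_pow]
    field_simp
  -- The integrals of the norms form the same binomial series with `|a|`, `‖b‖` and `s.re` in place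
  -- of `-a`, `-b` and `s`, so `hlt` justifies integrating term by term.
  have hnorm : ∀ p : ℕ × ℕ, ∫ t in Ioi 0, ‖F p t‖ = s.re ^ (-κ) *
      (((p.2 + p.1).choose p.1 : ℝ) * (‖b‖ * s.re ^ (-α)) ^ p.2 *
        (|a| * s.re ^ (-(α - β))) ^ p.1) := by
    intro p
    have hΓ := Real.Gamma_pos_of_pos (hx p)
    have h1 : ∫ t in Ioi 0, ‖F p t‖ = ∫ t in Ioi 0, ‖mlCoeff α β a κ b p‖ *
        (t ^ (α * p.2 + (κ + (α - β) * p.1) - 1) * Real.exp (-(s.re * t))) := by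
      refine setIntegral_congr_fun measurableSet_Ioi fun t ht => ?_
      simp only [hF]
      rw [norm_mul, norm_mul, Complex.norm_exp, Complex.norm_real, Real.norm_of_nonneg
        (Real.rpow_nonneg (le_of_lt ht) _)]
      simp
      ring
    rw [h1, integral_const_mul, Real.integral_rpow_mul_exp_neg_mul_Ioi (hx p) hs, one_div,
      Real.inv_rpow hs.le, ← Real.rpow_neg hs.le, rpow_exponent hs, mlCoeff]
    simp only [norm_mul, norm_div, norm_pow, Complex.norm_real, Complex.norm_natCast, norm_neg,
      Real.norm_eq_abs]
    rw [abs_of_pos hΓ, mul_pow, mul_pow]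
    field_simp
  have hsum : Summable fun p => ∫ t in Ioi 0, ‖F p t‖ := by
    simp_rw [hnorm]
    exact (summable_choose_mul_pow_mul_pow (by positivity) (by positivity) hlt).mul_left _
  have hae : ∀ t ∈ Ioi (0 : ℝ), HasSum (fun p => F p t)
      (Complex.exp (-s * t) * (((t ^ (κ - 1) : ℝ) : ℂ) * mlSeries α β a κ b t)) := fun t ht =>
    (rpow_mul_mlSeries hα hβ hκ b ht).mul_left _
  have hae' := (ae_restrict_iff' (μ := volume) (measurableSet_Ioi (a := (0 : ℝ)))).2
    (ae_of_all _ hae)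
  refine ⟨integrable_of_hasSum hint hsum hae', ?_⟩
  have h1 := hasSum_integral_of_summable_integral_norm hint hsum
  simp_rw [hval] at h1
  have hlt' : ‖-(a * s ^ (-((α - β : ℝ) : ℂ)))‖ + ‖-(b * s ^ (-(α : ℂ)))‖ < 1 := by
    refine lt_of_le_of_lt ?_ hlt
    rw [norm_neg, norm_neg, norm_mul, norm_mul, Complex.norm_real, Real.norm_eq_abs]
    have h2 := norm_cpow_neg_le hs (sub_pos.2 hβ).le
    have h3 := norm_cpow_neg_le hs hα.le
    gcongr
  have h2 := (hasSum_choose_mul_pow_mul_pow hlt').mul_left (s ^ (-(κ : ℂ)))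
  have h3 : laplaceT (fun t => ((t ^ (κ - 1) : ℝ) : ℂ) * mlSeries α β a κ b t) s =
      ∫ t in Ioi 0, ∑' p, F p t :=
    setIntegral_congr_fun measurableSet_Ioi fun t ht => (hae t ht).tsum_eq.symm
  rw [h3, ← h2.unique h1]
  congr 3
  ring

theorem denominator_ne_zero {b s : ℂ} (hα : 0 < α) (hβ : β < α)
    (hs : 0 < s.re) (hlt : |a| * s.re ^ (-(α - β)) + ‖b‖ * s.re ^ (-α) < 1) :
    1 + a * s ^ (-((α - β : ℝ) : ℂ)) + b * s ^ (-(α : ℂ)) ≠ 0 := by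
  intro h0
  have h1 : a * s ^ (-((α - β : ℝ) : ℂ)) + b * s ^ (-(α : ℂ)) = -1 := by linear_combination h0
  have h2 := norm_add_le (a * s ^ (-((α - β : ℝ) : ℂ))) (b * s ^ (-(α : ℂ)))
  rw [h1, norm_neg, norm_one, norm_mul, norm_mul, Complex.norm_real, Real.norm_eq_abs] at h2
  have h3 := mul_le_mul_of_nonneg_left (norm_cpow_neg_le hs (sub_pos.2 hβ).le) (abs_nonneg a)
  have h4 := mul_le_mul_of_nonneg_left (norm_cpow_neg_le hs hα.le) (norm_nonneg b)
  linarith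

theorem cpow_mul_denominator {b s : ℂ} (hs : s ≠ 0) :
    s ^ (α : ℂ) * (1 + a * s ^ (-((α - β : ℝ) : ℂ)) + b * s ^ (-(α : ℂ))) =
      s ^ (α : ℂ) + a * s ^ (β : ℂ) + b := by
  have h1 : s ^ (α : ℂ) * s ^ (-((α - β : ℝ) : ℂ)) = s ^ (β : ℂ) := by
    rw [← Complex.cpow_add _ _ hs]; congr 1; push_cast; ring
  have h2 : s ^ (α : ℂ) * s ^ (-(α : ℂ)) = 1 := by
    rw [← Complex.cpow_add _ _ hs]; simp
  linear_combination (a : ℂ) * h1 + b * h2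

/-- The series `t^(κ-1) * mlSeries` inverts `s^(α-κ) / (s^α + a s^β + b)`. -/
theorem exists_laplaceT_mlSeries (hα : 0 < α) (hβ : β < α) (a : ℝ) (b : ℂ) :
    ∃ σ : ℝ, 0 ≤ σ ∧ ∀ s : ℂ, σ < s.re → s ^ (α : ℂ) + a * s ^ (β : ℂ) + b ≠ 0 ∧
      ∀ κ : ℝ, 0 < κ →
      LaplaceIntegrable (fun t => ((t ^ (κ - 1) : ℝ) : ℂ) * mlSeries α β a κ b t) s ∧
      laplaceT (fun t => ((t ^ (κ - 1) : ℝ) : ℂ) * mlSeries α β a κ b t) s =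
        s ^ ((α - κ : ℝ) : ℂ) / (s ^ (α : ℂ) + a * s ^ (β : ℂ) + b) := by
  -- The threshold depends on `|a|`, `‖b‖` and the exponents `α`, `β` only, so one `σ` serves both
  -- `κ = α` and `κ = α - 1`.
  obtain ⟨σ, hσ1, hσ⟩ := exists_forall_rpow_add_rpow_lt_one hα (sub_pos.2 hβ) |a| ‖b‖
  refine ⟨σ, by linarith, fun s hs => ?_⟩
  have hs0 : 0 < s.re := by linarith
  have hne : s ≠ 0 := by rintro rfl; simp at hs0
  have hd := denominator_ne_zero hα hβ hs0 (hσ _ hs)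
  have hpow : s ^ (α : ℂ) ≠ 0 := by rw [Complex.cpow_ne_zero_iff]; exact Or.inl hne
  rw [← cpow_mul_denominator hne]
  refine ⟨mul_ne_zero hpow hd, fun κ hκ => ?_⟩
  obtain ⟨h1, h2⟩ := laplaceT_rpow_mul_mlSeries hα hβ hκ b hs0 (hσ _ hs)
  refine ⟨h1, ?_⟩
  have e : s ^ ((α - κ : ℝ) : ℂ) = s ^ (α : ℂ) * s ^ (-(κ : ℂ)) := by
    rw [← Complex.cpow_add _ _ hne]; congr 1; push_cast; ring
  rw [h2, e, mul_div_mul_left _ _ hpow]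
  ring

end

/-! ### Laplace transforms of Riemann-Liouville derivatives and of the equation in time. -/

theorem laplaceIntegrable_one {s : ℂ} (hs : 0 < s.re) : LaplaceIntegrable (fun _ => 1) s := by
  simpa using laplaceIntegrable_rpow one_pos hs

theorem laplaceT_one {s : ℂ} (hs : 0 < s.re) : laplaceT (fun _ => 1) s = s⁻¹ := by
  have := laplaceT_rpow one_pos hs
  simpa [Complex.cpow_neg_one] using this

/-- The Laplace transform of an antiderivative. -/
theorem laplaceT_of_hasDerivAt {P q : ℝ → ℂ} {c s : ℂ} (hs : 0 < s.re)
    (hd : ∀ t, 0 < t → HasDerivAt P (q t) t) (hc : Tendsto P (𝓝[>] 0) (𝓝 c))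
    (hq : LaplaceIntegrable q s) :
    LaplaceIntegrable P s ∧ laplaceT P s = s⁻¹ * (c + laplaceT q s) := by
  -- `P` is `c` plus the convolution of `q` with `1`; this avoids integration by parts and any
  -- condition on `P` at infinity.
  have hP : ∀ t, 0 < t → c * 1 + causalConv q (fun _ => 1) t = P t := by
    intro t ht
    have hint : IntervalIntegrable q volume 0 t :=
      (intervalIntegrable_iff_integrableOn_Ioc_of_le ht.le).2 (hq.locallyIntegrable t)
    have h := intervalIntegral.integral_eq_sub_of_hasDerivAt_of_tendsto ht
      (fun x hx => hd x hx.1) hint hc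
      ((hd t ht).continuousAt.tendsto.mono_left nhdsWithin_le_nhds)
    simp only [causalConv, mul_one]
    rw [h]; ring
  have h1 := laplaceIntegrable_one hs
  refine ⟨((h1.const_mul c).add (hq.causalConv h1)).congr_Ioi hP, ?_⟩
  rw [← laplaceT_congr_Ioi hP, laplaceT_add (h1.const_mul c) (hq.causalConv h1),
    laplaceT_const_mul, laplaceT_causalConv hq h1, laplaceT_one hs]
  ring

theorem rlOrder_sub_two {α : ℝ} (hα : 1 < α) : rlOrder α = rlOrder (α - 2) + 2 := by
  unfold rlOrder
  -- Since `α - 2 > -1`, the integer `⌊α - 2⌋ + 1` is nonnegative and `toNat` does not truncate.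
  have h : (-1 : ℤ) ≤ ⌊α - 2⌋ := Int.le_floor.2 (by push_cast; linarith)
  have h2 : ⌊α⌋ = ⌊α - 2⌋ + 2 := by
    have := Int.floor_sub_intCast α 2
    push_cast at this
    omega
  omega

theorem rlOrder_sub_one {α : ℝ} (hα : 1 < α) : rlOrder (α - 1) = rlOrder (α - 2) + 1 := by
  unfold rlOrder
  have h : (-1 : ℤ) ≤ ⌊α - 2⌋ := Int.le_floor.2 (by push_cast; linarith)
  have h2 : ⌊α - 1⌋ = ⌊α - 2⌋ + 1 := by
    have h3 := Int.floor_sub_intCast α 2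
    have h4 := Int.floor_sub_one α
    push_cast at h3
    omega
  omega

/-- The kernel exponent depends on `[ν] + 1 - ν` only, which is the same for `α`, `α - 1` and `α -
2`. The three are therefore consecutive derivatives of one fractional integral. -/
theorem hasDerivAt_rlDeriv_sub_two {α : ℝ} (hα : 1 < α) {u : ℝ → ℂ} (h : RLDifferentiable α u)
    {t : ℝ} (ht : 0 < t) : HasDerivAt (rlDeriv (α - 2) u) (rlDeriv (α - 1) u t) t := by
  have h1 := h.2 (rlOrder (α - 2)) (by rw [rlOrder_sub_two hα]; omega) t ht
  unfold rlDeriv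
  rw [rlOrder_sub_one hα, iteratedDeriv_succ]
  rw [rlOrder_sub_two hα] at h1
  push_cast at h1 ⊢
  rw [show (rlOrder (α - 2) : ℝ) + 1 - (α - 1) = rlOrder (α - 2) + 2 - α by ring,
    show (rlOrder (α - 2) : ℝ) - (α - 2) = rlOrder (α - 2) + 2 - α by ring]
  exact h1.hasDerivAt

theorem hasDerivAt_rlDeriv_sub_one {α : ℝ} (hα : 1 < α) {u : ℝ → ℂ} (h : RLDifferentiable α u)
    {t : ℝ} (ht : 0 < t) : HasDerivAt (rlDeriv (α - 1) u) (rlDeriv α u t) t := by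
  have h1 := h.2 (rlOrder (α - 2) + 1) (by rw [rlOrder_sub_two hα]; omega) t ht
  unfold rlDeriv
  rw [rlOrder_sub_one hα, rlOrder_sub_two hα, iteratedDeriv_succ (n := rlOrder (α - 2) + 1)]
  rw [rlOrder_sub_two hα] at h1
  push_cast at h1 ⊢
  rw [show (rlOrder (α - 2) : ℝ) + 1 - (α - 1) = rlOrder (α - 2) + 2 - α by ring]
  exact h1.hasDerivAt

/-- Needed for `α = 2`: order `0` has `[0] + 1 = 1`, so `D^0 u` is the derivative of `∫ u` and
equals `u` only almost everywhere, by Lebesgue differentiation. -/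
theorem rlDeriv_zero_ae {u : ℝ → ℂ} (hu : ∀ t, IntegrableOn u (Ioc 0 t)) :
    u =ᵐ[volume.restrict (Ioi 0)] rlDeriv 0 u := by
  have h0 : rlOrder 0 = 1 := by simp [rlOrder]
  have h1 : rlDeriv 0 u = deriv fun t => ∫ τ in (0 : ℝ)..t, u τ := by
    unfold rlDeriv rlIntegral
    simp [h0, iteratedDeriv_one]
  have h2 : ∀ᵐ x : ℝ, ∀ n : ℕ, x ∈ uIcc (0 : ℝ) n → ∀ c ∈ uIcc (0 : ℝ) n,
      HasDerivAt (fun t => ∫ τ in c..t, u τ) (u x) x := by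
    rw [ae_all_iff]
    intro n
    exact ((intervalIntegrable_iff_integrableOn_Ioc_of_le n.cast_nonneg).2
      (hu n)).ae_hasDerivAt_integral
  rw [EventuallyEq, ae_restrict_iff' measurableSet_Ioi]
  filter_upwards [h2] with x hx hx0
  obtain ⟨n, hn⟩ := exists_nat_ge x
  rw [h1]
  refine (hx n ?_ 0 left_mem_uIcc).deriv.symm
  rw [uIcc_of_le n.cast_nonneg]
  exact ⟨le_of_lt hx0, hn⟩

/-- The Laplace transform of `D^(α-2) u`, a fractional integral of order `2 - α`. -/
theorem laplaceT_rlDeriv_sub_two {α : ℝ} (hα : 1 < α) (hα2 : α ≤ 2) {u : ℝ → ℂ} {s : ℂ}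
    (hs : 0 < s.re) (hu : LaplaceIntegrable u s) :
    LaplaceIntegrable (rlDeriv (α - 2) u) s ∧
      laplaceT (rlDeriv (α - 2) u) s = s ^ ((α : ℂ) - 2) * laplaceT u s := by
  -- For `α < 2` the order is `0` and `D^(α-2) u` is a convolution with `t^(1-α) / Γ(2-α)`; for `α =
  -- 2` it is `u` almost everywhere.
  rcases hα2.lt_or_eq with h2 | rfl
  · have hc : 0 < 2 - α := by linarith
    have ho : rlOrder (α - 2) = 0 := by
      have : ⌊α - 2⌋ = -1 := by
        rw [Int.floor_eq_iff]; push_cast; constructor <;> linarith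
      simp [rlOrder, this]
    have hp := (laplaceIntegrable_rpow hc hs).const_mul ((1 / Real.Gamma (2 - α) : ℝ) : ℂ)
    have e : causalConv u (fun t => ((1 / Real.Gamma (2 - α) : ℝ) : ℂ) *
        ((t ^ (2 - α - 1) : ℝ) : ℂ)) = rlDeriv (α - 2) u := by
      ext t
      simp only [causalConv, rlDeriv, ho, iteratedDeriv_zero, rlIntegral]
      rw [← intervalIntegral.integral_const_mul]
      congr 1; ext ξ
      rw [show ((0 : ℕ) : ℝ) - (α - 2) = 2 - α by push_cast; ring]
      ring
    rw [← e]
    refine ⟨hu.causalConv hp, ?_⟩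
    rw [laplaceT_causalConv hu hp, laplaceT_const_mul, laplaceT_rpow hc hs, mul_comm, ← mul_assoc,
      ← Complex.ofReal_mul, one_div, inv_mul_cancel₀ (Real.Gamma_pos_of_pos hc).ne',
      Complex.ofReal_one, one_mul]
    congr 2
    push_cast
    ring
  · have h := rlDeriv_zero_ae hu.locallyIntegrable
    rw [sub_self]
    refine ⟨hu.congr h, ?_⟩
    rw [← laplaceT_congr h]
    simp

/-- The Laplace transform of the time-fractional equation with its initial conditions. -/
theorem laplaceT_equation {α β a : ℝ} (hα : 1 < α) (hα2 : α ≤ 2) (hβ : 1 < β) (hβ2 : β ≤ 2)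
    {u w : ℝ → ℂ} {f₁ f₂ g₁ g₂ s : ℂ} (hs : 0 < s.re)
    (huα : RLDifferentiable α u) (huβ : RLDifferentiable β u)
    (heq : ∀ t, 0 < t → rlDeriv α u t + a * rlDeriv β u t = w t)
    (h0 : HasInitialData α β a u f₁ f₂ g₁ g₂)
    (hu : LaplaceIntegrable u s) (hw : LaplaceIntegrable w s) :
    (s ^ (α : ℂ) + a * s ^ (β : ℂ)) * laplaceT u s =
      s * (g₁ + a * g₂) + (f₁ + a * f₂) + laplaceT w s := by
  have hne : s ≠ 0 := by rintro rfl; simp at hs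
  -- The combination is integrated as a whole: only its derivative `w` is known to be Laplace
  -- transformable, not `D^α u` and `D^β u` separately.
  obtain ⟨hi1, e1⟩ := laplaceT_of_hasDerivAt hs (fun t ht => by
    have := (hasDerivAt_rlDeriv_sub_one hα huα ht).add
      ((hasDerivAt_rlDeriv_sub_one hβ huβ ht).const_mul (a : ℂ))
    rw [heq t ht] at this
    exact this) h0.1 hw
  obtain ⟨hi2, e2⟩ := laplaceT_of_hasDerivAt hs (fun t ht =>
    (hasDerivAt_rlDeriv_sub_two hα huα ht).add
      ((hasDerivAt_rlDeriv_sub_two hβ huβ ht).const_mul (a : ℂ))) h0.2 hi1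
  obtain ⟨hj1, d1⟩ := laplaceT_rlDeriv_sub_two hα hα2 hs hu
  obtain ⟨hj2, d2⟩ := laplaceT_rlDeriv_sub_two hβ hβ2 hs hu
  have e3 := laplaceT_add hj1 (hj2.const_mul (a : ℂ))
  rw [laplaceT_const_mul, d1, d2] at e3
  have e4 : s ^ ((α : ℂ) - 2) * laplaceT u s + a * (s ^ ((β : ℂ) - 2) * laplaceT u s) =
    s⁻¹ * ((g₁ + a * g₂) + s⁻¹ * ((f₁ + a * f₂) + laplaceT w s)) := by
    rw [← e1, ← e3]; exact e2
  have hp : ∀ c : ℂ, s ^ c = s ^ 2 * s ^ (c - 2) := by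
    intro c
    rw [Complex.cpow_sub _ _ hne]
    have : s ^ (2 : ℂ) = s ^ 2 := by exact_mod_cast Complex.cpow_natCast s 2
    rw [this]; field_simp
  rw [hp α, hp β]
  have : (s ^ 2 * s ^ ((α : ℂ) - 2) + a * (s ^ 2 * s ^ ((β : ℂ) - 2))) * laplaceT u s =
    s ^ 2 * (s⁻¹ * ((g₁ + a * g₂) + s⁻¹ * ((f₁ + a * f₂) + laplaceT w s))) := by
    rw [← e4]; ring
  rw [this]
  field_simp
  ring

/-! ### Fourier transform in space and Fubini for the joint transform. -/

theorem norm_exp_I_mul (k x : ℝ) : ‖Complex.exp (Complex.I * k * x)‖ = 1 := by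
  rw [show Complex.I * k * x = ((k * x : ℝ) : ℂ) * Complex.I by push_cast; ring]
  exact Complex.norm_exp_ofReal_mul_I _

theorem integrable_exp_I_mul {f : ℝ → ℂ} (hf : Integrable f) (k : ℝ) :
    Integrable fun x : ℝ => Complex.exp (Complex.I * k * x) * f x :=
  hf.bdd_mul (c := 1) (by fun_prop) (ae_of_all _ fun x => (norm_exp_I_mul k x).le)

theorem fourierT_add {f g : ℝ → ℂ} (hf : Integrable f) (hg : Integrable g) (k : ℝ) :
    fourierT (fun x => f x + g x) k = fourierT f k + fourierT g k := by
  unfold fourierT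
  rw [← integral_add (integrable_exp_I_mul hf k) (integrable_exp_I_mul hg k)]
  simp [mul_add]

theorem fourierT_const_mul (c : ℂ) (f : ℝ → ℂ) (k : ℝ) :
    fourierT (fun x => c * f x) k = c * fourierT f k := by
  unfold fourierT
  rw [← integral_const_mul]
  congr 1; ext x; ring

theorem fourierT_sum {ι : Type*} (S : Finset ι) {f : ι → ℝ → ℂ}
    (hf : ∀ i ∈ S, Integrable (f i)) (k : ℝ) :
    fourierT (fun x => ∑ i ∈ S, f i x) k = ∑ i ∈ S, fourierT (f i) k := by
  unfold fourierT
  rw [← integral_finsetSum S fun i hi => integrable_exp_I_mul (hf i hi) k]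
  simp [Finset.mul_sum]

theorem fourierT_congr_ae {f g : ℝ → ℂ} (h : f =ᵐ[volume] g) (k : ℝ) :
    fourierT f k = fourierT g k :=
  integral_congr_ae (by filter_upwards [h] with x hx; rw [hx])

/-- Absolute convergence of the joint Laplace-Fourier transform at the Laplace variable `s`. -/
def JointlyIntegrableAt (u : ℝ → ℝ → ℂ) (s : ℂ) : Prop :=
  Integrable (fun p : ℝ × ℝ => Complex.exp (-s * p.2) * u p.1 p.2)
    ((volume : Measure ℝ).prod (volume.restrict (Ioi (0 : ℝ))))

theorem JointlyTransformable.exists_forall {u : ℝ → ℝ → ℂ} (h : JointlyTransformable u) :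
    ∃ σ : ℝ, ∀ s : ℂ, σ ≤ s.re → JointlyIntegrableAt u s := by
  obtain ⟨σ, hσ⟩ := h
  refine ⟨σ, fun s hs => ?_⟩
  have h1 := hσ.bdd_mul (c := 1) (f := fun p : ℝ × ℝ => Complex.exp (-(s - σ) * p.2))
    (by fun_prop) ?_
  · refine h1.congr (ae_of_all _ fun p => ?_)
    simp only
    rw [← mul_assoc, Complex.ofReal_exp, ← Complex.exp_add]
    congr 2
    push_cast
    ring
  · have h2 : ∀ᵐ t : ℝ ∂(volume.restrict (Ioi (0 : ℝ))), 0 < t :=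
      ae_restrict_mem measurableSet_Ioi
    filter_upwards [(Measure.quasiMeasurePreserving_snd (μ := (volume : Measure ℝ))
      (ν := volume.restrict (Ioi (0 : ℝ)))).ae h2] with p hp
    rw [Complex.norm_exp]
    refine Real.exp_le_one_iff.2 ?_
    simp
    nlinarith

namespace JointlyIntegrableAt

variable {u : ℝ → ℝ → ℂ} {s : ℂ}

theorem laplaceIntegrable_ae (h : JointlyIntegrableAt u s) :
    ∀ᵐ x : ℝ, LaplaceIntegrable (u x) s :=
  Integrable.prod_right_ae h

theorem integrable_laplaceT (h : JointlyIntegrableAt u s) :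
    Integrable fun x => laplaceT (u x) s :=
  Integrable.integral_prod_left h

theorem mul_exp (h : JointlyIntegrableAt u s) (k : ℝ) :
    Integrable (fun p : ℝ × ℝ => Complex.exp (Complex.I * k * p.1) *
      (Complex.exp (-s * p.2) * u p.1 p.2))
    ((volume : Measure ℝ).prod (volume.restrict (Ioi (0 : ℝ)))) :=
  Integrable.bdd_mul (c := 1) h (by fun_prop) (ae_of_all _ fun p => (norm_exp_I_mul k p.1).le)

theorem integral_mul_exp (u : ℝ → ℝ → ℂ) (s : ℂ) (k t : ℝ) :
    ∫ x : ℝ, Complex.exp (Complex.I * k * x) * (Complex.exp (-s * t) * u x t) =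
      Complex.exp (-s * t) * fourierT (fun x => u x t) k := by
  unfold fourierT
  rw [← integral_const_mul]
  congr 1; ext x; ring

theorem laplaceIntegrable_fourierT (h : JointlyIntegrableAt u s) (k : ℝ) :
    LaplaceIntegrable (fun t => fourierT (fun x => u x t) k) s := by
  have h1 := (h.mul_exp k).integral_prod_right
  simp_rw [integral_mul_exp] at h1
  exact h1

theorem fourierT_laplaceT (h : JointlyIntegrableAt u s) (k : ℝ) :
    fourierT (fun x => laplaceT (u x) s) k =
      laplaceT (fun t => fourierT (fun x => u x t) k) s := by
  have h1 := integral_integral_swap (f := fun x t : ℝ => Complex.exp (Complex.I * k * x) *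
    (Complex.exp (-s * t) * u x t)) (h.mul_exp k)
  simp_rw [integral_mul_exp, integral_const_mul] at h1
  exact h1

end JointlyIntegrableAt

/-! ### The algebraic equation for the joint transform. -/

/-- The Laplace-Fourier transform of a solution. -/
theorem IsSolutionWith.exists_laplaceT_fourierT {n : ℕ} {α β a : ℝ} {μ γ θ : Fin n → ℝ}
    (hα : 1 < α) (hα2 : α ≤ 2) (hβ : 1 < β) (hβ2 : β ≤ 2)
    {φ N : ℝ → ℝ → ℂ} {f₁ f₂ g₁ g₂ : ℝ → ℂ} {h : Fin n → ℝ → ℝ → ℂ}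
    (hf₁ : Integrable f₁) (hf₂ : Integrable f₂) (hg₁ : Integrable g₁) (hg₂ : Integrable g₂)
    (hφ : JointlyTransformable φ) (hN : IsSolutionWith α β a μ γ θ φ f₁ f₂ g₁ g₂ N h) :
    ∃ σ : ℝ, ∀ s : ℂ, σ < s.re → ∀ k : ℝ,
      LaplaceIntegrable (fun t => fourierT (fun x => N x t) k) s ∧
      LaplaceIntegrable (fun t => fourierT (fun x => φ x t) k) s ∧
      (s ^ (α : ℂ) + a * s ^ (β : ℂ) + totalSymbol μ γ θ k) *
        laplaceT (fun t => fourierT (fun x => N x t) k) s =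
        s * (fourierT g₁ k + a * fourierT g₂ k) + (fourierT f₁ k + a * fourierT f₂ k) +
          laplaceT (fun t => fourierT (fun x => φ x t) k) s := by
  obtain ⟨σN, hσN⟩ := hN.transformable.exists_forall
  obtain ⟨σφ, hσφ⟩ := hφ.exists_forall
  choose σh hσh using fun j => (hN.transformable_deriv j).exists_forall
  refine ⟨max 0 (max σN (max σφ (∑ j, |σh j|))), fun s hs k => ?_⟩
  simp only [max_lt_iff] at hs
  obtain ⟨hs0, hs1, hs2, hs3⟩ := hs
  have jN := hσN s hs1.le
  have jφ := hσφ s hs2.le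
  have jh : ∀ j, JointlyIntegrableAt (h j) s := fun j => by
    refine hσh j s (le_trans ?_ hs3.le)
    exact (le_abs_self _).trans
      (Finset.single_le_sum (f := fun j => |σh j|) (fun i _ => abs_nonneg _) (Finset.mem_univ j))
  refine ⟨jN.laplaceIntegrable_fourierT k, jφ.laplaceIntegrable_fourierT k, ?_⟩
  have hjh : ∀ᵐ x : ℝ, ∀ j, LaplaceIntegrable (h j x) s :=
    ae_all_iff.2 fun j => (jh j).laplaceIntegrable_ae
  -- Joint integrability gives Laplace integrability only for almost every `x`; the Fourier
  -- transform does not see the exceptional null set.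
  have hae : (fun x => (s ^ (α : ℂ) + a * s ^ (β : ℂ)) * laplaceT (N x) s) =ᵐ[volume]
      fun x => (s * (g₁ x + a * g₂ x) + (f₁ x + a * f₂ x)) +
        ((∑ j, (μ j : ℂ) * laplaceT (h j x) s) + laplaceT (φ x) s) := by
    filter_upwards [jN.laplaceIntegrable_ae, jφ.laplaceIntegrable_ae, hjh] with x h1 h2 h3
    have h4 : ∀ j ∈ Finset.univ, LaplaceIntegrable (fun t => (μ j : ℂ) * h j x t) s :=
      fun j _ => (h3 j).const_mul _
    have h5 := LaplaceIntegrable.sum Finset.univ h4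
    rw [laplaceT_equation hα hα2 hβ hβ2 hs0 (hN.rl_alpha x) (hN.rl_beta x)
      (fun t ht => hN.equation x t ht) (hN.initial x) h1 (h5.add h2), laplaceT_add h5 h2,
      laplaceT_sum _ h4]
    simp_rw [laplaceT_const_mul]
  have i1 : Integrable fun x => s * (g₁ x + a * g₂ x) := (hg₁.add (hg₂.const_mul _)).const_mul _
  have i2 : Integrable fun x => f₁ x + a * f₂ x := hf₁.add (hf₂.const_mul _)
  have i3 : ∀ j ∈ Finset.univ, Integrable fun x => (μ j : ℂ) * laplaceT (h j x) s :=
    fun j _ => (jh j).integrable_laplaceT.const_mul _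
  have i4 : Integrable fun x => ∑ j, (μ j : ℂ) * laplaceT (h j x) s := integrable_finsetSum _ i3
  have i5 := jφ.integrable_laplaceT
  have i6 : Integrable fun x => s * (g₁ x + a * g₂ x) + (f₁ x + a * f₂ x) := i1.add i2
  have i7 : Integrable fun x => (∑ j, (μ j : ℂ) * laplaceT (h j x) s) + laplaceT (φ x) s :=
    i4.add i5
  have key := fourierT_congr_ae hae k
  rw [fourierT_const_mul, fourierT_add i6 i7, fourierT_add i1 i2,
    fourierT_add i4 i5, fourierT_sum _ i3, fourierT_const_mul s, fourierT_add hg₁ (hg₂.const_mul _),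
    fourierT_add hf₁ (hf₂.const_mul _), fourierT_const_mul, fourierT_const_mul,
    jN.fourierT_laplaceT, jφ.fourierT_laplaceT] at key
  -- The Riesz-Feller relation holds at each fixed `t`, so the Fourier transform is brought inside
  -- the Laplace integral before it is applied.
  have hh : ∀ j, fourierT (fun x => (μ j : ℂ) * laplaceT (h j x) s) k =
      -((μ j : ℂ) * fellerSymbol (γ j) (θ j) k) *
        laplaceT (fun t => fourierT (fun x => N x t) k) s := by
    intro j
    rw [fourierT_const_mul, (jh j).fourierT_laplaceT, laplaceT_congr_Ioi
      (q := fun t => -(fellerSymbol (γ j) (θ j) k) * fourierT (fun x => N x t) k)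
      (fun t ht => (hN.riesz_feller j t ht).2.2 k), laplaceT_const_mul]
    ring
  simp_rw [hh] at key
  rw [← Finset.sum_mul, Finset.sum_neg_distrib] at key
  unfold totalSymbol
  linear_combination key

/-! ### The solution on the Fourier side. -/

/-- The convolution of a continuous kernel vanishing at `0` with an integrable function is
continuous. -/
theorem continuousOn_causalConv {p q : ℝ → ℂ} (hp : ContinuousOn p (Ici 0)) (hp0 : p 0 = 0)
    (hq : ∀ t, IntegrableOn q (Ioc 0 t)) : ContinuousOn (causalConv p q) (Ioi 0) := by
  intro t₀ ht₀
  refine ContinuousAt.continuousWithinAt ?_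
  simp only [mem_Ioi] at ht₀
  set T := t₀ + 1 with hT
  -- Since `p 0 = 0`, this extension vanishes for negative arguments. The convolution becomes an
  -- integral over the fixed interval `[0, T]`, where dominated convergence applies.
  set P : ℝ → ℂ := fun x => p (max x 0) with hP
  have hPc : Continuous P := by
    rw [← continuousOn_univ]
    exact hp.comp (by fun_prop) fun x _ => mem_Ici.2 (le_max_right _ _)
  have hqi : IntervalIntegrable q volume 0 T :=
    (intervalIntegrable_iff_integrableOn_Ioc_of_le (by linarith)).2 (hq T)
  have heq : ∀ t ∈ Ioo 0 T, ∫ ξ in (0 : ℝ)..T, P (t - ξ) * q ξ = causalConv p q t := by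
    intro t ht
    have hsub : ∀ c d, 0 ≤ c → c ≤ d → d ≤ T →
        IntervalIntegrable (fun ξ => P (t - ξ) * q ξ) volume c d := by
      intro c d hc hcd hd
      refine IntervalIntegrable.continuousOn_mul (hqi.mono_set ?_)
        (hPc.comp (by fun_prop : Continuous fun ξ : ℝ => t - ξ)).continuousOn
      rw [uIcc_of_le hcd, uIcc_of_le (by linarith)]
      exact Icc_subset_Icc hc hd
    rw [← intervalIntegral.integral_add_adjacent_intervals (hsub 0 t le_rfl ht.1.le ht.2.le)
      (hsub t T ht.1.le ht.2.le le_rfl)]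
    have h2 : ∫ ξ in t..T, P (t - ξ) * q ξ = 0 := by
      rw [intervalIntegral.integral_congr (g := fun _ => 0)]
      · simp
      · intro ξ hξ
        rw [uIcc_of_le ht.2.le] at hξ
        simp only [hP]
        rw [max_eq_right (by linarith [hξ.1]), hp0, zero_mul]
    rw [h2, add_zero]
    have h3 := intervalIntegral.integral_comp_sub_left (a := 0) (b := t)
      (fun ξ => p (t - ξ) * q ξ) t
    simp only [sub_self, sub_zero, sub_sub_cancel] at h3
    rw [causalConv, h3]
    refine intervalIntegral.integral_congr fun ξ hξ => ?_
    rw [uIcc_of_le ht.1.le] at hξ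
    simp only [hP]
    rw [max_eq_left (by linarith [hξ.2])]
  have hnhds : Ioo 0 T ∈ 𝓝 t₀ := Ioo_mem_nhds ht₀ (by linarith)
  have hev : (fun t => ∫ ξ in (0 : ℝ)..T, P (t - ξ) * q ξ) =ᶠ[𝓝 t₀] causalConv p q := by
    filter_upwards [hnhds] with t ht using heq t ht
  refine ContinuousAt.congr ?_ hev
  obtain ⟨C, hC⟩ := isCompact_Icc.exists_bound_of_continuousOn (s := Icc (-T) T) hPc.continuousOn
  refine intervalIntegral.continuousAt_of_dominated_interval (bound := fun ξ => C * ‖q ξ‖)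
    (Eventually.of_forall fun t => ?_) ?_ (hqi.norm.const_mul C) (ae_of_all _ fun ξ _ => ?_)
  · exact ((hPc.comp (by fun_prop : Continuous fun ξ : ℝ => t - ξ)).aestronglyMeasurable).mul
      hqi.def'.aestronglyMeasurable
  · filter_upwards [hnhds] with t ht
    refine ae_of_all _ fun ξ hξ => ?_
    rw [uIoc_of_le (by linarith)] at hξ
    rw [norm_mul]
    exact mul_le_mul_of_nonneg_right
      (hC _ ⟨by linarith [hξ.2, ht.1], by linarith [hξ.1, ht.2]⟩) (norm_nonneg _)
  · exact ((hPc.comp (by fun_prop : Continuous fun t : ℝ => t - ξ)).mul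
      continuous_const).continuousAt

/-- The Fourier transform in space of a solution, with the sum inside the convolution. -/
theorem IsSolutionWith.fourierT_eq {n : ℕ} {α β a : ℝ} {μ γ θ : Fin n → ℝ}
    (hα : 1 < α) (hα2 : α ≤ 2) (hβ : 1 < β) (hαβ : β < α)
    {φ N : ℝ → ℝ → ℂ} {f₁ f₂ g₁ g₂ : ℝ → ℂ} {h : Fin n → ℝ → ℝ → ℂ}
    (hf₁ : Integrable f₁) (hf₂ : Integrable f₂) (hg₁ : Integrable g₁) (hg₂ : Integrable g₂)
    (hφ : JointlyTransformable φ) (hN : IsSolutionWith α β a μ γ θ φ f₁ f₂ g₁ g₂ N h)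
    {t : ℝ} (ht : 0 < t) (k : ℝ) :
    fourierT (fun y => N y t) k =
      ((t ^ (α - 1) : ℝ) : ℂ) * (fourierT f₁ k + a * fourierT f₂ k) *
        mlSeries α β a α (totalSymbol μ γ θ k) t +
      ((t ^ (α - 2) : ℝ) : ℂ) * (fourierT g₁ k + a * fourierT g₂ k) *
        mlSeries α β a (α - 1) (totalSymbol μ γ θ k) t +
      causalConv (fun ξ => ((ξ ^ (α - 1) : ℝ) : ℂ) * mlSeries α β a α (totalSymbol μ γ θ k) ξ)
        (fun t => fourierT (fun y => φ y t) k) t := by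
  have hα0 : 0 < α := by linarith
  set b := totalSymbol μ γ θ k with hb
  set F := fourierT f₁ k + a * fourierT f₂ k with hF
  set G := fourierT g₁ k + a * fourierT g₂ k with hG
  set Nk : ℝ → ℂ := fun t => fourierT (fun y => N y t) k with hNk
  set φk : ℝ → ℂ := fun t => fourierT (fun y => φ y t) k with hφk
  set p : ℝ → ℂ := fun ξ => ((ξ ^ (α - 1) : ℝ) : ℂ) * mlSeries α β a α b ξ with hp
  set q : ℝ → ℂ := fun ξ => ((ξ ^ (α - 1 - 1) : ℝ) : ℂ) * mlSeries α β a (α - 1) b ξ with hq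
  obtain ⟨σ₁, h₁⟩ := hN.exists_laplaceT_fourierT hα hα2 hβ (by linarith) hf₁ hf₂ hg₁ hg₂ hφ
  obtain ⟨σ₂, hσ₂, h₂⟩ := exists_laplaceT_mlSeries hα0 hαβ a b
  -- The candidate: `p` has transform `1/(s^α + a s^β + b)` and `q` has `s/(s^α + a s^β + b)`.
  set M : ℝ → ℂ := fun t => F * p t + G * q t + causalConv p φk t with hM
  have key : ∀ s : ℂ, max σ₁ σ₂ < s.re →
      LaplaceIntegrable (fun t => Nk t + (-1) * M t) s ∧
      laplaceT (fun t => Nk t + (-1) * M t) s = 0 := by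
    intro s hs
    rw [max_lt_iff] at hs
    have hne : s ≠ 0 := by
      rintro rfl
      have := hs.2
      simp only [Complex.zero_re] at this
      linarith
    obtain ⟨i1, i2, e⟩ := h₁ s hs.1 k
    obtain ⟨hd, h₃⟩ := h₂ s hs.2
    obtain ⟨j1, e1⟩ := h₃ α hα0
    obtain ⟨j2, e2⟩ := h₃ (α - 1) (by linarith)
    have k1 := j1.const_mul F
    have k2 := j2.const_mul G
    have k3 := j1.causalConv i2
    have hMi : LaplaceIntegrable M s := (k1.add k2).add k3
    refine ⟨i1.add (hMi.const_mul (-1)), ?_⟩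
    have hMe : laplaceT M s = F * laplaceT p s + G * laplaceT q s + laplaceT p s * laplaceT φk s := by
      rw [hM, laplaceT_add (k1.add k2) k3, laplaceT_add k1 k2, laplaceT_const_mul,
        laplaceT_const_mul, laplaceT_causalConv j1 i2]
    rw [laplaceT_add i1 (hMi.const_mul (-1)), laplaceT_const_mul, hMe, e1, e2]
    have e3 : s ^ ((α - α : ℝ) : ℂ) = 1 := by simp
    have e4 : s ^ ((α - (α - 1) : ℝ) : ℂ) = s := by simp
    rw [e3, e4]
    have e5 : laplaceT Nk s = (s * G + F + laplaceT φk s) /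
        (s ^ (α : ℂ) + a * s ^ (β : ℂ) + b) := by
      rw [eq_div_iff hd, mul_comm]; exact e
    rw [e5]
    field_simp
    ring
  set σ := max σ₁ σ₂ + 1 with hσ
  have hz := ae_eq_zero_of_laplaceT_eq_zero (σ := σ) (key σ (by simp [hσ])).1
    (fun s hs => (key s (by rw [hs, hσ]; linarith)).2)
  have hpc : ContinuousOn p (Ici 0) := by
    refine ContinuousOn.mul (Continuous.continuousOn ?_)
      (continuousOn_mlSeries hα0 hαβ hα0 b)
    exact Complex.continuous_ofReal.comp
      (Continuous.rpow_const continuous_id fun _ => Or.inr (by linarith))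
  -- Here `α > 1` matters. The kernel `q`, with exponent `α - 2 ≤ 0`, may be singular at `0`, but it
  -- is not convolved.
  have hp0 : p 0 = 0 := by
    simp only [hp]
    rw [Real.zero_rpow (by linarith)]
    simp
  have hqc : ContinuousOn q (Ioi 0) := by
    refine ContinuousOn.mul ?_ ((continuousOn_mlSeries hα0 hαβ (by linarith) b).mono
      Ioi_subset_Ici_self)
    exact Complex.continuous_ofReal.comp_continuousOn
      (ContinuousOn.rpow_const continuousOn_id fun x hx => Or.inl (ne_of_gt hx))
  have hφi : ∀ t, IntegrableOn φk (Ioc 0 t) :=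
    (h₁ (σ₁ + 1 : ℝ) (by simp) k).2.1.locallyIntegrable
  have hMc : ContinuousOn M (Ioi 0) :=
    ((continuousOn_const.mul (hpc.mono Ioi_subset_Ici_self)).add
      (continuousOn_const.mul hqc)).add (continuousOn_causalConv hpc hp0 hφi)
  -- Almost everywhere equality of continuous functions on an open set is equality.
  have heq : EqOn Nk M (Ioi 0) := by
    refine Measure.eqOn_open_of_ae_eq (μ := volume) ?_ isOpen_Ioi (hN.continuous_time k) hMc
    filter_upwards [hz] with t ht
    have : Nk t + (-1) * M t = 0 := ht
    linear_combination this
  have := heq ht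
  simp only [hNk, hM, hp, hq] at this
  rw [this, show α - 1 - 1 = α - 2 by ring]
  ring

/-! ### Convolution term by term. -/

theorem rpow_mul_mlTerm {α β a : ℝ} (b : ℂ) {ξ : ℝ} (hξ : 0 < ξ) (r : ℕ) :
    ((ξ ^ (α - 1) : ℝ) : ℂ) * mlTerm α β a α b ξ r =
      ((-a : ℝ) : ℂ) ^ r * ((ξ ^ (α + (α - β) * r - 1) : ℝ) : ℂ) *
        prabhakar (r + 1) α (α + (α - β) * r) (-b * ((ξ ^ α : ℝ) : ℂ)) := by
  have : ξ ^ (α + (α - β) * r - 1) = ξ ^ (α - 1) * ξ ^ ((α - β) * r) := by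
    rw [← Real.rpow_add hξ]; congr 1; ring
  rw [this, mlTerm]
  push_cast
  ring

/-- Convolution with the series can be carried out term by term. -/
theorem hasSum_causalConv_mlTerm {α β a : ℝ} (hα : 1 < α) (hαβ : β < α) (b : ℂ) {q : ℝ → ℂ}
    {t : ℝ} (ht : 0 < t) (hq : IntegrableOn q (Ioc 0 t)) :
    HasSum (fun r : ℕ => ((-a : ℝ) : ℂ) ^ r * ∫ ξ in (0 : ℝ)..t,
      q (t - ξ) * ((ξ ^ (α + (α - β) * r - 1) : ℝ) : ℂ) *
        prabhakar (r + 1) α (α + (α - β) * r) (-b * ((ξ ^ α : ℝ) : ℂ)))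
      (causalConv (fun ξ => ((ξ ^ (α - 1) : ℝ) : ℂ) * mlSeries α β a α b ξ) q t) := by
  have hα0 : 0 < α := by linarith
  -- The majorant `t^(α-1) u r ‖q(t-ξ)‖` is summable in `r` and its sum is integrable in `ξ`, as
  -- dominated convergence for series requires.
  obtain ⟨u, hu, hle⟩ := exists_tsum_norm_mlTerm_le (a := a) hα0 hαβ hα0 b t
  have hqi : IntervalIntegrable q volume 0 t :=
    (intervalIntegrable_iff_integrableOn_Ioc_of_le ht.le).2 hq
  have hqr : IntervalIntegrable (fun ξ => q (t - ξ)) volume 0 t := by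
    have := (hqi.comp_sub_left t).symm
    simpa using this
  have hpow : Continuous fun ξ : ℝ => ((ξ ^ (α - 1) : ℝ) : ℂ) :=
    Complex.continuous_ofReal.comp
      (Continuous.rpow_const continuous_id fun _ => Or.inr (by linarith))
  have h := intervalIntegral.hasSum_integral_of_dominated_convergence (a := 0) (b := t)
    (μ := volume) (F := fun (r : ℕ) ξ => ((ξ ^ (α - 1) : ℝ) : ℂ) * mlTerm α β a α b ξ r * q (t - ξ))
    (f := fun ξ => ((ξ ^ (α - 1) : ℝ) : ℂ) * mlSeries α β a α b ξ * q (t - ξ))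
    (fun r ξ => t ^ (α - 1) * u r * ‖q (t - ξ)‖) ?_ ?_ ?_ ?_ ?_
  · refine h.congr_fun ?_
    intro r
    rw [← intervalIntegral.integral_const_mul]
    refine intervalIntegral.integral_congr_ae (ae_of_all _ fun ξ hξ => ?_)
    rw [uIoc_of_le ht.le] at hξ
    rw [rpow_mul_mlTerm b hξ.1]
    ring
  · intro r
    refine AEStronglyMeasurable.mul (ContinuousOn.aestronglyMeasurable ?_ measurableSet_uIoc)
      hqr.def'.aestronglyMeasurable
    refine hpow.continuousOn.mul ((continuousOn_mlTerm hα0 hαβ hα0 b r).mono ?_)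
    rw [uIoc_of_le ht.le]
    exact fun x hx => hx.1.le
  · refine fun r => ae_of_all _ fun ξ hξ => ?_
    rw [uIoc_of_le ht.le] at hξ
    rw [norm_mul, norm_mul, Complex.norm_real, Real.norm_of_nonneg (Real.rpow_nonneg hξ.1.le _)]
    have h1 := hle ξ r hξ.1.le hξ.2
    have h2 : ξ ^ (α - 1) ≤ t ^ (α - 1) := Real.rpow_le_rpow hξ.1.le hξ.2 (by linarith)
    have h3 := Real.rpow_nonneg hξ.1.le (α - 1)
    gcongr
  · exact ae_of_all _ fun ξ _ => (hu.mul_left _).mul_right _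
  · simp_rw [tsum_mul_right]
    exact hqr.norm.const_mul _
  · refine ae_of_all _ fun ξ hξ => ?_
    rw [uIoc_of_le ht.le] at hξ
    exact (((summable_norm_mlTerm hα0 hαβ hα0 b hξ.1.le).of_norm.hasSum).mul_left _).mul_right _

/-! ### Fourier inversion. -/

/-- Fourier inversion for the convention of `fourierT`. -/
theorem fourierT_inversion {f : ℝ → ℂ} (hc : Continuous f) (hf : Integrable f)
    (hF : Integrable (fourierT f)) (x : ℝ) :
    f x = 1 / (2 * Real.pi) * ∫ k : ℝ, fourierT f k * Complex.exp (-(Complex.I * k * x)) := by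
  -- The kernel `exp(+ikx)` makes `fourierT` a rescaled `fourierInv`, so the forward transform
  -- recovers `f`; the rescaling by `2π` produces the factor `1/(2π)`.
  have e1 : ∀ w : ℝ, FourierTransformInv.fourierInv f w = fourierT f (2 * Real.pi * w) := by
    intro w
    rw [Real.fourierInv_eq']
    unfold fourierT
    congr 1; ext v
    rw [smul_eq_mul]
    congr 2
    simp
    ring
  have hpi : (2 * Real.pi) ≠ 0 := by positivity
  have hF' : Integrable (FourierTransformInv.fourierInv f) := by
    rw [funext e1]
    exact hF.comp_mul_left' hpi
  have hF'' : Integrable (FourierTransform.fourier f) := by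
    have h2 := hF'.comp_neg
    refine h2.congr (ae_of_all _ fun w => ?_)
    simp only
    rw [Real.fourierInv_eq_fourier_neg, neg_neg]
  have h1 := congrFun (hc.fourier_fourierInv_eq hf hF'') x
  rw [← h1, Real.fourier_real_eq_integral_exp_smul]
  have h3 := Measure.integral_comp_mul_left
    (fun k : ℝ => fourierT f k * Complex.exp (-(Complex.I * k * x))) (2 * Real.pi)
  rw [abs_of_pos (by positivity), Complex.real_smul] at h3
  have h4 : (((2 * Real.pi)⁻¹ : ℝ) : ℂ) = 1 / (2 * Real.pi) := by push_cast; rw [one_div]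
  rw [← h4, ← h3]
  congr 1; ext v
  rw [e1, smul_eq_mul, mul_comm]
  congr 2
  push_cast
  ring

theorem norm_exp_neg_I_mul (k x : ℝ) : ‖Complex.exp (-(Complex.I * k * x))‖ = 1 := by
  rw [show -(Complex.I * k * x) = ((-(k * x) : ℝ) : ℂ) * Complex.I by push_cast; ring]
  exact Complex.norm_exp_ofReal_mul_I _

theorem integrable_mul_exp_neg {A : ℝ → ℂ} (hA : Integrable A) (x : ℝ) :
    Integrable fun k : ℝ => A k * Complex.exp (-(Complex.I * k * x)) :=
  hA.mul_bdd (c := 1) (by fun_prop) (ae_of_all _ fun k => (norm_exp_neg_I_mul k x).le)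

theorem integrable_prod_mul_exp_neg {ν : Measure ℝ} {Q : ℝ × ℝ → ℂ}
    (hQ : Integrable Q (ν.prod volume)) (x : ℝ) :
    Integrable (fun p : ℝ × ℝ => Q p * Complex.exp (-(Complex.I * p.2 * x))) (ν.prod volume) :=
  hQ.mul_bdd (c := 1) (by fun_prop) (ae_of_all _ fun p => (norm_exp_neg_I_mul p.2 x).le)

/-- Fourier inversion of a sum of two integrable functions and an integral with a parameter. -/
theorem fourierT_inversion_add {f A B : ℝ → ℂ} {Q : ℝ → ℝ → ℂ} {t : ℝ} (ht : 0 ≤ t)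
    (hc : Continuous f) (hf : Integrable f) (hA : Integrable A) (hB : Integrable B)
    (hQ : Integrable (fun p : ℝ × ℝ => Q p.1 p.2)
      ((volume.restrict (Ioc (0 : ℝ) t)).prod volume))
    (h : ∀ k, fourierT f k = A k + B k + ∫ ξ in (0 : ℝ)..t, Q ξ k) (x : ℝ) :
    f x = 1 / (2 * Real.pi) * ((∫ k : ℝ, A k * Complex.exp (-(Complex.I * k * x))) +
      (∫ k : ℝ, B k * Complex.exp (-(Complex.I * k * x))) +
      ∫ ξ in (0 : ℝ)..t, ∫ k : ℝ, Q ξ k * Complex.exp (-(Complex.I * k * x))) := by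
  -- Fubini turns absolute convergence in `(ξ, k)` into integrability in `k`. Hence `f^*` is
  -- integrable, as inversion requires.
  have hC : Integrable fun k => ∫ ξ in (0 : ℝ)..t, Q ξ k := by
    simp_rw [intervalIntegral.integral_of_le ht]
    exact hQ.integral_prod_right
  have hF : Integrable (fourierT f) := by
    rw [funext h]
    exact (hA.add hB).add hC
  rw [fourierT_inversion hc hf hF]
  congr 1
  simp_rw [h, add_mul]
  rw [integral_add (by exact (integrable_mul_exp_neg hA x).add (integrable_mul_exp_neg hB x))
      (integrable_mul_exp_neg hC x),
    integral_add (integrable_mul_exp_neg hA x) (integrable_mul_exp_neg hB x)]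
  congr 1
  simp_rw [intervalIntegral.integral_of_le ht]
  rw [integral_integral_swap (f := fun (ξ k : ℝ) => Q ξ k * Complex.exp (-(Complex.I * k * x)))
    (integrable_prod_mul_exp_neg hQ x)]
  congr 1; ext k
  rw [integral_mul_const]

/-- Term by term inversion of a series that converges absolutely as a sum of integrals. -/
theorem hasSum_integral_integral_mul_exp_neg {T : ℕ → ℝ → ℝ → ℂ} {Q : ℝ → ℝ → ℂ} {t : ℝ}
    (ht : 0 ≤ t)
    (hT : ∀ r, Integrable (fun p : ℝ × ℝ => T r p.1 p.2)
      ((volume.restrict (Ioc (0 : ℝ) t)).prod volume))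
    (hs : Summable fun r => ∫ p : ℝ × ℝ, ‖T r p.1 p.2‖
      ∂((volume.restrict (Ioc (0 : ℝ) t)).prod volume))
    (hsum : ∀ ξ ∈ Ioc 0 t, ∀ k, HasSum (fun r => T r ξ k) (Q ξ k)) :
    Integrable (fun p : ℝ × ℝ => Q p.1 p.2) ((volume.restrict (Ioc (0 : ℝ) t)).prod volume) ∧
    ∀ x : ℝ, HasSum
      (fun r => ∫ ξ in (0 : ℝ)..t, ∫ k : ℝ, T r ξ k * Complex.exp (-(Complex.I * k * x)))
      (∫ ξ in (0 : ℝ)..t, ∫ k : ℝ, Q ξ k * Complex.exp (-(Complex.I * k * x))) := by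
  -- The pointwise expansion is known for `ξ ∈ (0, t]` only, which is almost everywhere for this
  -- product measure.
  have hmem : ∀ᵐ p : ℝ × ℝ ∂((volume.restrict (Ioc (0 : ℝ) t)).prod volume), p.1 ∈ Ioc 0 t :=
    (Measure.quasiMeasurePreserving_fst (μ := volume.restrict (Ioc (0 : ℝ) t))
      (ν := (volume : Measure ℝ))).ae (ae_restrict_mem measurableSet_Ioc)
  have hQ : Integrable (fun p : ℝ × ℝ => Q p.1 p.2)
      ((volume.restrict (Ioc (0 : ℝ) t)).prod volume) := by
    refine integrable_of_hasSum hT hs ?_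
    filter_upwards [hmem] with p hp using hsum p.1 hp p.2
  refine ⟨hQ, fun x => ?_⟩
  have h1 := hasSum_integral_of_summable_integral_norm
    (fun r => integrable_prod_mul_exp_neg (hT r) x)
    (by simpa only [norm_mul, norm_exp_neg_I_mul, mul_one] using hs)
  have h2 : ∫ p : ℝ × ℝ, ∑' r, T r p.1 p.2 * Complex.exp (-(Complex.I * p.2 * x))
      ∂((volume.restrict (Ioc (0 : ℝ) t)).prod volume) =
      ∫ p : ℝ × ℝ, Q p.1 p.2 * Complex.exp (-(Complex.I * p.2 * x))
      ∂((volume.restrict (Ioc (0 : ℝ) t)).prod volume) := by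
    refine integral_congr_ae ?_
    filter_upwards [hmem] with p hp
    rw [tsum_mul_right, (hsum p.1 hp p.2).tsum_eq]
  rw [h2, integral_prod _ (integrable_prod_mul_exp_neg hQ x)] at h1
  simp_rw [fun r => integral_prod _ (integrable_prod_mul_exp_neg (hT r) x)] at h1
  simp_rw [intervalIntegral.integral_of_le ht]
  exact h1

end

/-! ### The theorem. -/

/-- Convergence of the series, their Laplace transforms, and the representation of the solution
on the Fourier side, as an inverse Fourier transform, and with the sum taken outside. -/
theorem theorem2 {n : ℕ} (α β a : ℝ) (μ γ θ : Fin n → ℝ)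
    (hα : 1 < α ∧ α ≤ 2) (hβ : 1 < β ∧ β ≤ 2) (hαβ : β < α)
    (hμ : ∀ j, 0 < μ j) (hγ : ∀ j, 0 < γ j ∧ γ j ≤ 2)
    (hθ : ∀ j, |θ j| ≤ min (γ j) (2 - γ j)) :
    -- convergence of the series
    (∀ κ : ℝ, (κ = α ∨ κ = α - 1) → ∀ (b : ℂ) (t : ℝ), 0 < t →
      (∀ r : ℕ, Summable
        (prabhakarTerm (r + 1) α (κ + (α - β) * r) (-b * ((t ^ α : ℝ) : ℂ)))) ∧
      Summable (mlTerm α β a κ b t)) ∧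
    -- the series invert `1 / (s^α + a s^β + b)` and `s / (s^α + a s^β + b)`
    (∀ κ : ℝ, (κ = α ∨ κ = α - 1) → ∀ b : ℂ, ∃ σ : ℝ, 0 ≤ σ ∧ ∀ s : ℂ, σ < s.re →
      s ^ (α : ℂ) + a * s ^ (β : ℂ) + b ≠ 0 ∧
      IntegrableOn (fun t : ℝ => Complex.exp (-s * t) *
        (((t ^ (κ - 1) : ℝ) : ℂ) * mlSeries α β a κ b t)) (Ioi 0) ∧
      ∫ t in Ioi (0 : ℝ), Complex.exp (-s * t) *
        (((t ^ (κ - 1) : ℝ) : ℂ) * mlSeries α β a κ b t) =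
          s ^ ((α - κ : ℝ) : ℂ) / (s ^ (α : ℂ) + a * s ^ (β : ℂ) + b)) ∧
    -- the solution
    (∀ (f₁ f₂ g₁ g₂ : ℝ → ℂ) (φ N : ℝ → ℝ → ℂ),
      Integrable f₁ → Integrable f₂ → Integrable g₁ → Integrable g₂ →
      JointlyTransformable φ →
      IsSolution α β a μ γ θ φ f₁ f₂ g₁ g₂ N →
      ∀ t : ℝ, 0 < t →
        -- the Fourier transform of the solution
        (∀ k : ℝ, ∃ S : ℂ,
          HasSum (fun r : ℕ => ((-a : ℝ) : ℂ) ^ r * ∫ ξ in (0 : ℝ)..t,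
            fourierT (fun y => φ y (t - ξ)) k * ((ξ ^ (α + (α - β) * r - 1) : ℝ) : ℂ) *
              prabhakar (r + 1) α (α + (α - β) * r)
                (-(totalSymbol μ γ θ k) * ((ξ ^ α : ℝ) : ℂ))) S ∧
          fourierT (fun y => N y t) k =
            ((t ^ (α - 1) : ℝ) : ℂ) * (fourierT f₁ k + a * fourierT f₂ k) *
              mlSeries α β a α (totalSymbol μ γ θ k) t +
            ((t ^ (α - 2) : ℝ) : ℂ) * (fourierT g₁ k + a * fourierT g₂ k) *
              mlSeries α β a (α - 1) (totalSymbol μ γ θ k) t + S) ∧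
        -- the solution as an inverse Fourier transform, whenever the integrals converge
        (Integrable (fun k : ℝ => (fourierT f₁ k + a * fourierT f₂ k) *
            mlSeries α β a α (totalSymbol μ γ θ k) t) →
          Integrable (fun k : ℝ => (fourierT g₁ k + a * fourierT g₂ k) *
            mlSeries α β a (α - 1) (totalSymbol μ γ θ k) t) →
          -- sum inside the integrals
          (Integrable (fun p : ℝ × ℝ => ((p.1 ^ (α - 1) : ℝ) : ℂ) *
              (fourierT (fun y => φ y (t - p.1)) p.2 *
                mlSeries α β a α (totalSymbol μ γ θ p.2) p.1))
              ((volume.restrict (Ioc (0 : ℝ) t)).prod volume) →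
            ∀ x : ℝ, N x t =
              ((t ^ (α - 1) : ℝ) : ℂ) / (2 * Real.pi) *
                (∫ k : ℝ, (fourierT f₁ k + a * fourierT f₂ k) *
                  mlSeries α β a α (totalSymbol μ γ θ k) t *
                    Complex.exp (-(Complex.I * k * x))) +
              ((t ^ (α - 2) : ℝ) : ℂ) / (2 * Real.pi) *
                (∫ k : ℝ, (fourierT g₁ k + a * fourierT g₂ k) *
                  mlSeries α β a (α - 1) (totalSymbol μ γ θ k) t *
                    Complex.exp (-(Complex.I * k * x))) +
              1 / (2 * Real.pi) *
                (∫ ξ in (0 : ℝ)..t, ((ξ ^ (α - 1) : ℝ) : ℂ) *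
                  (∫ k : ℝ, fourierT (fun y => φ y (t - ξ)) k *
                    mlSeries α β a α (totalSymbol μ γ θ k) ξ *
                      Complex.exp (-(Complex.I * k * x))))) ∧
          -- sum outside the integrals
          ((∀ r : ℕ, Integrable (fun p : ℝ × ℝ =>
              ((-a : ℝ) : ℂ) ^ r * ((p.1 ^ (α + (α - β) * r - 1) : ℝ) : ℂ) *
              (fourierT (fun y => φ y (t - p.1)) p.2 *
                prabhakar (r + 1) α (α + (α - β) * r)
                  (-(totalSymbol μ γ θ p.2) * ((p.1 ^ α : ℝ) : ℂ))))
              ((volume.restrict (Ioc (0 : ℝ) t)).prod volume)) →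
            Summable (fun r : ℕ => ∫ p : ℝ × ℝ,
              ‖((-a : ℝ) : ℂ) ^ r * ((p.1 ^ (α + (α - β) * r - 1) : ℝ) : ℂ) *
              (fourierT (fun y => φ y (t - p.1)) p.2 *
                prabhakar (r + 1) α (α + (α - β) * r)
                  (-(totalSymbol μ γ θ p.2) * ((p.1 ^ α : ℝ) : ℂ)))‖
              ∂((volume.restrict (Ioc (0 : ℝ) t)).prod volume)) →
            ∀ x : ℝ, ∃ S : ℂ,
              HasSum (fun r : ℕ => ((-a : ℝ) : ℂ) ^ r / (2 * Real.pi) *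
                ∫ ξ in (0 : ℝ)..t, ((ξ ^ (α + (α - β) * r - 1) : ℝ) : ℂ) *
                  ∫ k : ℝ, fourierT (fun y => φ y (t - ξ)) k *
                    Complex.exp (-(Complex.I * k * x)) *
                    prabhakar (r + 1) α (α + (α - β) * r)
                      (-(totalSymbol μ γ θ k) * ((ξ ^ α : ℝ) : ℂ))) S ∧
              N x t =
                ((t ^ (α - 1) : ℝ) : ℂ) / (2 * Real.pi) *
                  (∫ k : ℝ, (fourierT f₁ k + a * fourierT f₂ k) *
                    mlSeries α β a α (totalSymbol μ γ θ k) t *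
                      Complex.exp (-(Complex.I * k * x))) +
                ((t ^ (α - 2) : ℝ) : ℂ) / (2 * Real.pi) *
                  (∫ k : ℝ, (fourierT g₁ k + a * fourierT g₂ k) *
                    mlSeries α β a (α - 1) (totalSymbol μ γ θ k) t *
                      Complex.exp (-(Complex.I * k * x))) + S))) := by
  have hα0 : 0 < α := by linarith [hα.1]
  have hκ0 : ∀ κ : ℝ, (κ = α ∨ κ = α - 1) → 0 < κ := by
    rintro κ (rfl | rfl) <;> linarith [hα.1]
  refine ⟨fun κ hκ b t ht => ⟨fun r => ?_, ?_⟩, fun κ hκ b => ?_, ?_⟩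
  · exact summable_prabhakarTerm hα0 hαβ (hκ0 κ hκ) b ht r
  · exact (summable_norm_mlTerm hα0 hαβ (hκ0 κ hκ) b ht.le).of_norm
  · obtain ⟨σ, hσ, h⟩ := exists_laplaceT_mlSeries hα0 hαβ a b
    exact ⟨σ, hσ, fun s hs => ⟨(h s hs).1, (h s hs).2 κ (hκ0 κ hκ)⟩⟩
  intro f₁ f₂ g₁ g₂ φ N hf₁ hf₂ hg₁ hg₂ hφ hsol t ht
  obtain ⟨h, hN⟩ := hsol
  have hform := fun k => hN.fourierT_eq hα.1 hα.2 hβ.1 hαβ hf₁ hf₂ hg₁ hg₂ hφ ht k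
  set b := totalSymbol μ γ θ with hb
  set Q : ℝ → ℝ → ℂ := fun ξ k => ((ξ ^ (α - 1) : ℝ) : ℂ) *
    (fourierT (fun y => φ y (t - ξ)) k * mlSeries α β a α (b k) ξ) with hQdef
  have hconv : ∀ k, causalConv (fun ξ => ((ξ ^ (α - 1) : ℝ) : ℂ) * mlSeries α β a α (b k) ξ)
      (fun t => fourierT (fun y => φ y t) k) t = ∫ ξ in (0 : ℝ)..t, Q ξ k := by
    intro k
    unfold causalConv
    congr 1; ext ξ
    simp only [hQdef]
    ring
  refine ⟨fun k => ⟨_, ?_, hform k⟩, fun hA hB => ?_⟩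
  · obtain ⟨σ, hσ⟩ := hφ.exists_forall
    have hq := ((hσ (σ : ℂ) (by simp)).laplaceIntegrable_fourierT k).locallyIntegrable t
    exact hasSum_causalConv_mlTerm (a := a) (q := fun t => fourierT (fun y => φ y t) k)
      hα.1 hαβ (b k) ht hq
  -- Both forms of the solution come from this inversion; they differ in how integrability of `Q` is
  -- obtained.
  have hinv : Integrable (fun p : ℝ × ℝ => Q p.1 p.2)
      ((volume.restrict (Ioc (0 : ℝ) t)).prod volume) → ∀ x : ℝ, N x t =
      ((t ^ (α - 1) : ℝ) : ℂ) / (2 * Real.pi) *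
        (∫ k : ℝ, (fourierT f₁ k + a * fourierT f₂ k) * mlSeries α β a α (b k) t *
          Complex.exp (-(Complex.I * k * x))) +
      ((t ^ (α - 2) : ℝ) : ℂ) / (2 * Real.pi) *
        (∫ k : ℝ, (fourierT g₁ k + a * fourierT g₂ k) * mlSeries α β a (α - 1) (b k) t *
          Complex.exp (-(Complex.I * k * x))) +
      1 / (2 * Real.pi) * (∫ ξ in (0 : ℝ)..t, ∫ k : ℝ, Q ξ k *
        Complex.exp (-(Complex.I * k * x))) := by
    intro hQ x
    have hA' := hA.const_mul ((t ^ (α - 1) : ℝ) : ℂ)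
    have hB' := hB.const_mul ((t ^ (α - 2) : ℝ) : ℂ)
    rw [fourierT_inversion_add ht.le (hN.continuous_space t ht) (hN.integrable_space t ht)
      hA' hB' hQ (fun k => by rw [hform k, hconv k]; ring) x]
    simp_rw [mul_assoc ((t ^ (α - 1) : ℝ) : ℂ), mul_assoc ((t ^ (α - 2) : ℝ) : ℂ),
      integral_const_mul]
    ring
  refine ⟨fun hQ x => ?_, fun hT hTs x => ?_⟩
  · rw [hinv hQ x]
    congr 2
    refine intervalIntegral.integral_congr fun ξ _ => ?_
    simp only [hQdef]
    rw [← integral_const_mul]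
    congr 1; ext k
    ring
  -- Integrability of `Q` is deduced here from the summable integrals of the norms, together with
  -- the termwise expansion of the last term.
  · obtain ⟨hQ, hsum⟩ := hasSum_integral_integral_mul_exp_neg (Q := Q)
      (T := fun r ξ k => ((-a : ℝ) : ℂ) ^ r * ((ξ ^ (α + (α - β) * r - 1) : ℝ) : ℂ) *
        (fourierT (fun y => φ y (t - ξ)) k * prabhakar (r + 1) α (α + (α - β) * r)
          (-(b k) * ((ξ ^ α : ℝ) : ℂ)))) ht.le hT hTs (fun ξ hξ k => by
        have h1 := ((summable_norm_mlTerm (a := a) hα0 hαβ hα0 (b k) hξ.1.le).of_norm.hasSum).mul_left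
          (((ξ ^ (α - 1) : ℝ) : ℂ) * fourierT (fun y => φ y (t - ξ)) k)
        have h2 : Q ξ k = ((ξ ^ (α - 1) : ℝ) : ℂ) * fourierT (fun y => φ y (t - ξ)) k *
            ∑' r, mlTerm α β a α (b k) ξ r := mul_assoc _ _ _ |>.symm
        rw [h2]
        refine h1.congr_fun fun r => ?_
        have h3 := rpow_mul_mlTerm (β := β) (a := a) (α := α) (b k) hξ.1 r
        linear_combination (-fourierT (fun y => φ y (t - ξ)) k) * h3)
    refine ⟨_, ?_, hinv hQ x⟩
    refine ((hsum x).mul_left (1 / (2 * Real.pi : ℂ))).congr_fun fun r => ?_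
    rw [div_eq_mul_one_div, mul_comm (((-a : ℝ) : ℂ) ^ r), mul_assoc,
      ← intervalIntegral.integral_const_mul]
    congr 1
    refine intervalIntegral.integral_congr fun ξ _ => ?_
    rw [← integral_const_mul, ← integral_const_mul]
    congr 1; ext k
    ring
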